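/- **Tile assembly.** Let $A$ be an alphabet. A *glue* is a pair (label, strength) in $A^*\times\mathbb N$; a *tile type* assigns a glue to each of the four sides of a unit square (tiles are not rotated). For $V\subseteq\mathbb Z^2$, the *full grid graph* of $V$ has vertex set $V$, and its edges are the pairs of points at Euclidean distance $1$. A *configuration* $\alpha$ over a tile set $T$ is a partial function from $\mathbb Z^2$ to $T$; it is an *assembly* if $\operatorname{dom}\alpha$ is non-empty and its full grid graph is connected. Two adjacent tiles of $\alpha$ *bind* if the glues on their abutting sides are equal, in label and strength, and have positive strength; the *binding graph* of $\alpha$ has vertex set $\operatorname{dom}\alpha$ and an edge, weighted by the common strength, for each pair of binding tiles. For $\tau\in\mathbb Z^+$, $\alpha$ is *$\tau$-stable* if every set of edges whose removal leaves the binding graph disconnected has total weight at least $\tau$. A *tile assembly system* (TAS) is a triple $\mathcal T=(T,\sigma,\tau)$ with a finite tile set $T$, a temperature $\tau\in\mathbb Z^+$ and a finite $\tau$-stable seed assembly $\sigma$ over $T$. One-step production $\alpha\to_1\beta$ means that $\alpha,\beta$ are $\tau$-stable assemblies over $T$, $\beta$ extends $\alpha$, and $|\operatorname{dom}\beta\setminus\operatorname{dom}\alpha|=1$.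 An assembly $\alpha$ is *producible* if there is a finite or infinite sequence of assemblies $\sigma=\alpha_0\to_1\alpha_1\to_1\cdots$ of length $|\operatorname{dom}\alpha\setminus\operatorname{dom}\sigma|+1$, all of whose members are restrictions of $\alpha$, with $\operatorname{dom}\alpha=\bigcup_i\operatorname{dom}\alpha_i$. It is *terminal* if it is $\tau$-stable and there is no $\beta$ with $\alpha\to_1\beta$. The system $\mathcal T$ *strictly self-assembles* $X\subseteq\mathbb Z^2$ if every producible terminal assembly of $\mathcal T$ has domain exactly $X$. **Fractals.** Let $g>1$ be an integer and $\mathbb N_g=\{0,\dots,g-1\}$. A *$g$-discrete self-similar fractal* is a set $\mathbf X=\bigcup_{i\ge 1}X_i$ with $X_1=G$ and $X_{i+1}=\{\vec m+g^i\vec n : \vec m\in X_i,\ \vec n\in G\}$, where $\{(0,0)\}\subsetneq G\subsetneq\mathbb N_g^2$ and $G$ has at least one point in every row and in every column of $\mathbb N_g^2$. A *tree fractal* is a set that is a $g$-discrete self-similar fractal for some $g>1$ and whose full grid graph is a tree. For $c\in\mathbb Z^+$ and $X\subseteq\mathbb Z^2$, put $X^c=\{(x,y)\in\mathbb Z^2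 : (\lfloor x/c\rfloor,\lfloor y/c\rfloor)\in X\}$. **Corollary.** Let $\mathbf T$ be any tree fractal and let $c\in\mathbb Z^+$. Then $\mathbf T^c$ does not strictly self-assemble in the abstract Tile Assembly Model: over any alphabet, there is no tile assembly system that strictly self-assembles $\mathbf T^c$. -/

import Mathlib

open scoped ENNReal

/-! The abstract Tile Assembly Model on the integer lattice, and discrete self-similar fractals. -/

namespace ATAM

/-- The four sides of a unit square tile. -/
inductive Dir
  | N | E | S | W
  deriving DecidableEq

instance : Fintype Dir := ⟨{.N, .E, .S, .W}, fun d => by cases d <;> decide⟩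

/-- The unit vector pointing out of a side. -/
def Dir.vec : Dir → ℤ × ℤ
  | .N => (0, 1)
  | .E => (1, 0)
  | .S => (0, -1)
  | .W => (-1, 0)

/-- The opposite side. -/
def Dir.opp : Dir → Dir
  | .N => .S
  | .E => .W
  | .S => .N
  | .W => .E

/-- The integer grid: two points are adjacent iff their Euclidean distance is `1`,
that is, iff the sum of the absolute differences of their coordinates is `1`. -/
def grid : SimpleGraph (ℤ × ℤ) where
  Adj p q := |p.1 - q.1| + |p.2 - q.2| = 1
  symm := ⟨fun p q h => by rw [abs_sub_comm q.1, abs_sub_comm q.2]; exact h⟩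
  loopless := ⟨fun p h => by simp at h⟩

/-- The full grid graph of a set of lattice points. -/
def fullGridGraph (V : Set (ℤ × ℤ)) : SimpleGraph V := grid.induce V

/-- A glue over the alphabet `A`: a finite string (label) and a strength. -/
abbrev Glue (A : Type*) := List A × ℕ

/-- A tile type: one glue for each of the four sides. -/
abbrev TileType (A : Type*) := Dir → Glue A

/-- A configuration: a partial function from the lattice to tile types. -/
abbrev Config (A : Type*) := ℤ × ℤ → Option (TileType A)

variable {A : Type*}

/-- The domain of a configuration. -/
def dom (α : Config A) : Set (ℤ × ℤ) := {p | α p ≠ none}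

open Classical in
/-- The strength with which the tile at `p` interacts with its neighbour on side `d`: if both
positions are occupied and the abutting glues are equal (in label and strength), this common
strength; otherwise `0`. -/
noncomputable def sideStrength (α : Config A) (p : ℤ × ℤ) (d : Dir) : ℕ :=
  match α p, α (p + d.vec) with
  | some t, some u => if t d = u d.opp then (t d).2 else 0
  | _, _ => 0

open Classical in
/-- The strength of the interaction between positions `p` and `q`
(`0` if they are not adjacent; at most one summand is not `0`). -/
noncomputable def bondStrength (α : Config A) (p q : ℤ × ℤ) : ℕ :=
  ∑ d : Dir, if q = p + d.vec then sideStrength α p d else 0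

theorem sideStrength_opp (α : Config A) (p : ℤ × ℤ) (d : Dir) :
    sideStrength α (p + d.vec) d.opp = sideStrength α p d := by
  have h : p + d.vec + d.opp.vec = p := by
    cases d <;> ext <;> simp [Dir.vec, Dir.opp]
  have ho : d.opp.opp = d := by cases d <;> rfl
  unfold sideStrength
  rw [h, ho]
  cases α p <;> cases α (p + d.vec) <;> simp only []
  rename_i t u
  by_cases e : t d = u d.opp
  · simp [e]
  · rw [if_neg e, if_neg (fun h => e h.symm)]

theorem bondStrength_comm (α : Config A) (p q : ℤ × ℤ) :
    bondStrength α p q = bondStrength α q p := by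
  unfold bondStrength
  refine Finset.sum_nbij' Dir.opp Dir.opp (by simp) (by simp)
    (by rintro (_ | _ | _ | _) _ <;> rfl) (by rintro (_ | _ | _ | _) _ <;> rfl) ?_
  intro d _
  have h : q = p + d.vec ↔ p = q + d.opp.vec := by
    constructor
    · rintro rfl; cases d <;> ext <;> simp [Dir.vec, Dir.opp]
    · rintro rfl; cases d <;> ext <;> simp [Dir.vec, Dir.opp]
  by_cases hq : q = p + d.vec
  · rw [if_pos hq, if_pos (h.1 hq), hq, sideStrength_opp]
  · rw [if_neg hq, if_neg (fun hp => hq (h.2 hp))]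

theorem bondStrength_self (α : Config A) (p : ℤ × ℤ) : bondStrength α p p = 0 := by
  unfold bondStrength
  refine Finset.sum_eq_zero fun d _ => if_neg fun h => ?_
  have h1 := congrArg Prod.fst h
  have h2 := congrArg Prod.snd h
  cases d <;> simp [Dir.vec] at h1 h2

/-- The binding graph of a configuration: its vertices are the occupied positions, its edges the
pairs of positions whose tiles interact with positive strength. -/
def bindingGraph (α : Config A) : SimpleGraph (dom α) where
  Adj p q := 0 < bondStrength α p.1 q.1
  symm := ⟨fun p q h => by rw [bondStrength_comm]; exact h⟩
  loopless := ⟨fun p h => by rw [bondStrength_self] at h; exact lt_irrefl 0 h⟩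

/-- The weight of an edge of the binding graph: the strength of the glue it represents. -/
noncomputable def edgeWeight (α : Config A) : Sym2 (dom α) → ℕ :=
  Sym2.lift ⟨fun p q => bondStrength α p.1 q.1, fun p q => bondStrength_comm α p.1 q.1⟩

/-- A cut-set of a graph: a set of edges whose removal leaves a disconnected graph. -/
def IsCutSet {V : Type*} (G : SimpleGraph V) (C : Set (Sym2 V)) : Prop :=
  C ⊆ G.edgeSet ∧ ¬ (G.deleteEdges C).Preconnected

/-- A configuration is `τ`-stable if every cut-set of its binding graph has weight at least `τ`
(a cut-set may be infinite, so weights are sums in `[0, ∞]`). -/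
def IsStable (τ : ℕ) (α : Config A) : Prop :=
  ∀ C : Set (Sym2 (dom α)), IsCutSet (bindingGraph α) C →
    (τ : ℝ≥0∞) ≤ ∑' e : C, (edgeWeight α e.1 : ℝ≥0∞)

/-- `α` is an assembly of tiles from `T`: a connected, non-empty configuration over `T`. -/
def IsAssembly (T : Set (TileType A)) (α : Config A) : Prop :=
  (∀ p t, α p = some t → t ∈ T) ∧ (dom α).Nonempty ∧ (fullGridGraph (dom α)).Connected

/-- `α` is a subassembly of `β`. -/
def Subassembly (α β : Config A) : Prop :=
  dom α ⊆ dom β ∧ ∀ p ∈ dom α, α p = β p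

/-- A tile assembly system `(T, σ, τ)`: a finite tile set, a finite `τ`-stable seed assembly,
and a positive temperature. -/
structure TAS (A : Type*) where
  /-- the tile set -/
  tiles : Set (TileType A)
  tiles_finite : tiles.Finite
  /-- the temperature -/
  temp : ℕ
  temp_pos : 0 < temp
  /-- the seed -/
  seed : Config A
  seed_assembly : IsAssembly tiles seed
  seed_finite : (dom seed).Finite
  seed_stable : IsStable temp seed

namespace TAS

variable (𝒯 : TAS A)

/-- `α` produces `β` in one step. -/
def Step (α β : Config A) : Prop :=
  (IsAssembly 𝒯.tiles α ∧ IsStable 𝒯.temp α) ∧ (IsAssembly 𝒯.tiles β ∧ IsStable 𝒯.temp β) ∧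
    Subassembly α β ∧ (dom β \ dom α).encard = 1

/-- The frontier of `α`: the empty locations at which a tile can stably attach to `α`. -/
def frontier (α : Config A) : Set (ℤ × ℤ) :=
  {p | ∃ β, 𝒯.Step α β ∧ p ∈ dom β \ dom α}

/-- A sequence of `k` assemblies (`k` positive or infinite), given as the values of `a` at the
indices `i < k`, each of which produces the next one in one step. -/
def IsAssemblySequence (k : ℕ∞) (a : ℕ → Config A) : Prop :=
  (∀ i : ℕ, (i : ℕ∞) < k → IsAssembly 𝒯.tiles (a i)) ∧
    ∀ i : ℕ, ((i + 1 : ℕ) : ℕ∞) < k → 𝒯.Step (a i) (a (i + 1))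

/-- `α` produces `β` in zero or more, possibly infinitely many, steps. -/
def Produces (α β : Config A) : Prop :=
  ∃ (k : ℕ∞) (a : ℕ → Config A), k = (dom β \ dom α).encard + 1 ∧
    𝒯.IsAssemblySequence k a ∧ a 0 = α ∧
    dom β = ⋃ (i : ℕ) (_ : (i : ℕ∞) < k), dom (a i) ∧
    ∀ i : ℕ, (i : ℕ∞) < k → Subassembly (a i) β

/-- The producible assemblies: those produced from the seed. -/
def producible : Set (Config A) := {α | 𝒯.Produces 𝒯.seed α}

/-- `α` is terminal: it is stable and no tile can stably attach to it. -/
def IsTerminal (α : Config A) : Prop :=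
  IsStable 𝒯.temp α ∧ 𝒯.frontier α = ∅

/-- The producible terminal assemblies. -/
def terminalAssemblies : Set (Config A) := {α | α ∈ 𝒯.producible ∧ 𝒯.IsTerminal α}

/-- `𝒯` strictly self-assembles `X`: every producible terminal assembly has domain `X`. -/
def StrictlySelfAssembles (X : Set (ℤ × ℤ)) : Prop :=
  ∀ α ∈ 𝒯.terminalAssemblies, dom α = X

end TAS

/-- The `c`-scaling of a set of lattice points (for `0 < c`, `/` on `ℤ` is the floor of the
quotient): every point is replaced by a `c × c` block. -/
def scaling (c : ℕ) (X : Set (ℤ × ℤ)) : Set (ℤ × ℤ) :=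
  {p | (p.1 / (c : ℤ), p.2 / (c : ℤ)) ∈ X}

/-- The stages of the fractal with generator `G`, indexed from `0`: `stage g G i` is the stage
usually written `X_{i+1}`, with `X_1 = G` and `X_{i+1} = X_i + g ^ i G`. -/
def stage (g : ℕ) (G : Set (ℤ × ℤ)) : ℕ → Set (ℤ × ℤ)
  | 0 => G
  | i + 1 => {p | ∃ m ∈ stage g G i, ∃ n ∈ G, p = m + ((g : ℤ) ^ (i + 1)) • n}

/-- `G` is a generator of size `g`: a set `{(0,0)} ⊂ G ⊂ {0, …, g-1}²` (proper inclusions) with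
at least one point in every row and every column. -/
def IsGenerator (g : ℕ) (G : Set (ℤ × ℤ)) : Prop :=
  {(0, 0)} ⊂ G ∧ G ⊂ Set.Ico (0 : ℤ) g ×ˢ Set.Ico (0 : ℤ) g ∧
    (∀ x ∈ Set.Ico (0 : ℤ) g, ∃ y, (x, y) ∈ G) ∧ (∀ y ∈ Set.Ico (0 : ℤ) g, ∃ x, (x, y) ∈ G)

/-- `X` is a `g`-discrete self-similar fractal: the union of the stages of some generator. -/
def IsDSSF (g : ℕ) (X : Set (ℤ × ℤ)) : Prop :=
  1 < g ∧ ∃ G, IsGenerator g G ∧ X = ⋃ i : ℕ, stage g G i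

/-- A tree fractal: a discrete self-similar fractal whose full grid graph is a tree. -/
def IsTreeFractal (X : Set (ℤ × ℤ)) : Prop :=
  (∃ g : ℕ, IsDSSF g X) ∧ (fullGridGraph X).IsTree

end ATAM

/-!
Suppose that a tile assembly system strictly self-assembles the scaling `T^c` of a tree fractal `T`.

*Existence of growth.* Greedy attachment of tiles is fair, so every assembly that is reachable in
finitely many steps extends to a producible terminal assembly, and therefore stays inside `T^c`
(`StrictlySelfAssembles.dom_subset`). In particular some infinite assembly sequence fills `T^c`
(`StrictlySelfAssembles.exists_seq`).

*Exchange of branches.* Root the tree `T` at the origin. The cone of a point `q` (the points that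
`q` separates from the root) is joined to the rest of `T` by one edge, so all interaction between the
two sides in `T^c` passes between two neighbouring `c × c` blocks. If the tiles in these blocks and
their order of arrival (the movie) agree at `q` and `q'`, then the growth of the cone of `q'` can be
replayed, translated, in the place of the cone of `q` (`splice_reachable`). The replay never meets
another part of `T`: the first tile that left the cone of `q` would lie outside `T`, which is
impossible for a reachable assembly. So the two cones are translates of each other
(`branch_subset_of_sameMovie`). As there are finitely many movies and the seed is finite, all but
finitely many cones of `T` fall into finitely many classes up to translation
(`StrictlySelfAssembles.exists_key`).

*Growth of trees with finitely many cones.* By König's lemma and the pigeonhole principle, every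
infinite subset of `T` has infinitely many points in a periodic cone, that is, the cone of some `q`
with a descendant `q'` whose cone is its translate by `v = q' - q` (`IsParent.exists_isPeriod`).
If the cone of such a `q` contains a periodic cone, of apex `s` and period `w`, that is disjoint
from the cone of `q'`, then the points `s + k v + l w` are distinct and belong to `T`. Otherwise each
periodic cone is a finite set repeated along its period, and `T` is covered by finitely many of them
and a finite set, so that `T` grows linearly (`IsParent.sector_or_linearGrowth`).

*Contradiction.* The fractal has `|G|^i` points in the square of side `g^i`. Since `|G| < g²`, it
contains no family `s + k v + l w` (`IsGenerator.not_sector`). Since the origin has a neighbour in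
`T`, the generator has two points in a row or in a column, so `|G| > g` and the growth is not linear
(`IsGenerator.lt_ncard_of_connected`, `IsGenerator.not_linearGrowth`).
-/

namespace ATAM

variable {A : Type*}

/-! ### Stability as a condition on sets of positions -/

/-- The total strength of the bonds of `α` between positions in `S` and positions outside `S`. -/
noncomputable def cutWeight (α : Config A) (S : Set (ℤ × ℤ)) : ℝ≥0∞ :=
  ∑' z : (ℤ × ℤ) × (ℤ × ℤ), {z | z.1 ∈ S ∧ z.2 ∉ S}.indicator
    (fun z => (bondStrength α z.1 z.2 : ℝ≥0∞)) z

theorem mem_dom {α : Config A} {p : ℤ × ℤ} : p ∈ dom α ↔ α p ≠ none := Iff.rfl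

theorem notMem_dom {α : Config A} {p : ℤ × ℤ} : p ∉ dom α ↔ α p = none := by
  simp [mem_dom]

theorem mem_dom_of_sideStrength_pos {α : Config A} {p : ℤ × ℤ} {d : Dir}
    (h : 0 < sideStrength α p d) : p ∈ dom α ∧ p + d.vec ∈ dom α := by
  unfold sideStrength at h
  simp only [mem_dom]
  cases h1 : α p <;> cases h2 : α (p + d.vec) <;> simp_all

/-- A side interacts at least as strongly in any configuration that, up to a translation, shows
the same two tiles there. -/
theorem sideStrength_le {α β : Config A} {p q : ℤ × ℤ} {d : Dir}
    (h : 0 < sideStrength α p d → β q = α p ∧ β (q + d.vec) = α (p + d.vec)) :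
    sideStrength α p d ≤ sideStrength β q d := by
  rcases Nat.eq_zero_or_pos (sideStrength α p d) with h0 | h0
  · omega
  · obtain ⟨h1, h2⟩ := h h0
    unfold sideStrength
    rw [h1, h2]

theorem Subassembly.apply_eq {α β : Config A} (h : Subassembly α β) {p : ℤ × ℤ}
    (hp : p ∈ dom α) : β p = α p := (h.2 p hp).symm

theorem Subassembly.refl (α : Config A) : Subassembly α α := ⟨subset_rfl, fun _ _ => rfl⟩

theorem Subassembly.trans {α β γ : Config A} (h : Subassembly α β) (h' : Subassembly β γ) :
    Subassembly α γ :=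
  ⟨h.1.trans h'.1, fun p hp => (h.2 p hp).trans (h'.2 p (h.1 hp))⟩

theorem Subassembly.bondStrength_le {α β : Config A} (h : Subassembly α β) (p q : ℤ × ℤ) :
    bondStrength α p q ≤ bondStrength β p q := by
  unfold bondStrength
  refine Finset.sum_le_sum fun d _ => ?_
  split_ifs
  · refine sideStrength_le fun h0 => ?_
    obtain ⟨h1, h2⟩ := mem_dom_of_sideStrength_pos h0
    exact ⟨h.apply_eq h1, h.apply_eq h2⟩
  · exact le_rfl

theorem Subassembly.cutWeight_le {α β : Config A} (h : Subassembly α β) (S : Set (ℤ × ℤ)) :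
    cutWeight α S ≤ cutWeight β S := by
  refine ENNReal.tsum_le_tsum fun z => Set.indicator_le_indicator ?_
  exact_mod_cast h.bondStrength_le _ _

theorem exists_sideStrength_of_bondStrength_pos {α : Config A} {p q : ℤ × ℤ}
    (h : 0 < bondStrength α p q) : ∃ d : Dir, q = p + d.vec ∧ 0 < sideStrength α p d := by
  unfold bondStrength at h
  obtain ⟨d, _, hd⟩ := Finset.exists_ne_zero_of_sum_ne_zero h.ne'
  by_cases hq : q = p + d.vec
  · exact ⟨d, hq, by rw [if_pos hq] at hd; omega⟩
  · simp [hq] at hd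

theorem mem_dom_of_bondStrength_pos {α : Config A} {p q : ℤ × ℤ}
    (h : 0 < bondStrength α p q) : p ∈ dom α ∧ q ∈ dom α := by
  obtain ⟨d, rfl, hd⟩ := exists_sideStrength_of_bondStrength_pos h
  exact mem_dom_of_sideStrength_pos hd

theorem cutWeight_compl (α : Config A) (S : Set (ℤ × ℤ)) : cutWeight α Sᶜ = cutWeight α S := by
  unfold cutWeight
  rw [← (Equiv.prodComm (ℤ × ℤ) (ℤ × ℤ)).tsum_eq]
  refine tsum_congr fun z => ?_
  by_cases h1 : z.1 ∈ S <;> by_cases h2 : z.2 ∈ S <;>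
    simp [Set.indicator, h1, h2, bondStrength_comm]

/-- A configuration is stable iff every splitting of its domain into two non-empty parts is
crossed by bonds of total strength at least `τ`. -/
theorem isStable_iff {τ : ℕ} {α : Config A} : IsStable τ α ↔
    ∀ S : Set (ℤ × ℤ), (dom α ∩ S).Nonempty → (dom α \ S).Nonempty →
      (τ : ℝ≥0∞) ≤ cutWeight α S := by
  constructor
  · rintro h S ⟨x, hx, hxS⟩ ⟨y, hy, hyS⟩
    let C : Set (Sym2 (dom α)) :=
      {e | e ∈ (bindingGraph α).edgeSet ∧ ∃ p q : dom α, e = s(p, q) ∧ p.1 ∈ S ∧ q.1 ∉ S}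
    have hC : IsCutSet (bindingGraph α) C := by
      refine ⟨fun e he => he.1, fun hpre => ?_⟩
      obtain ⟨w⟩ := hpre ⟨x, hx⟩ ⟨y, hy⟩
      have key : ∀ (u v : dom α) (w : ((bindingGraph α).deleteEdges C).Walk u v),
          u.1 ∈ S → v.1 ∈ S := by
        intro u v w
        induction w with
        | nil => exact id
        | cons hadj _ ih =>
          intro hu
          refine ih ?_
          rw [SimpleGraph.deleteEdges_adj] at hadj
          by_contra hv
          exact hadj.2 ⟨hadj.1, _, _, rfl, hu, hv⟩
      exact hyS (key _ _ w hxS)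
    refine (h C hC).trans ?_
    have hrep : ∀ e : C, ∃ z : (ℤ × ℤ) × (ℤ × ℤ), ∃ p q : dom α, e.1 = s(p, q) ∧
        p.1 ∈ S ∧ q.1 ∉ S ∧ z = (p.1, q.1) := by
      rintro ⟨e, he, p, q, hpq, hp, hq⟩
      exact ⟨_, p, q, hpq, hp, hq, rfl⟩
    choose f hf using hrep
    have hinj : Function.Injective f := by
      intro e e' hee
      obtain ⟨p, q, h1, -, -, h2⟩ := hf e
      obtain ⟨p', q', h1', -, -, h2'⟩ := hf e'
      rw [h2, h2', Prod.mk.injEq] at hee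
      refine Subtype.ext ?_
      rw [h1, h1', Subtype.ext hee.1, Subtype.ext hee.2]
    refine le_trans (le_of_eq (tsum_congr fun e => ?_))
      (ENNReal.tsum_comp_le_tsum_of_injective hinj _)
    obtain ⟨p, q, h1, hp, hq, h2⟩ := hf e
    rw [h1, h2, Set.indicator_of_mem (by exact ⟨hp, hq⟩)]
    rfl
  · rintro h C ⟨-, hpre⟩
    unfold SimpleGraph.Preconnected at hpre
    push Not at hpre
    obtain ⟨x, y, hxy⟩ := hpre
    -- split along the connected component of `x` after the removal of `C`
    let S : Set (ℤ × ℤ) :=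
      {p | ∃ hp : p ∈ dom α, ((bindingGraph α).deleteEdges C).Reachable x ⟨p, hp⟩}
    have hS := h S ⟨x.1, x.2, x.2, SimpleGraph.Reachable.refl _⟩
      ⟨y.1, y.2, fun ⟨_, hr⟩ => hxy hr⟩
    refine hS.trans ?_
    unfold cutWeight
    rw [← tsum_subtype]
    have hsupp : ∀ z : {z : (ℤ × ℤ) × (ℤ × ℤ) | z.1 ∈ S ∧ z.2 ∉ S},
        0 < bondStrength α z.1.1 z.1.2 →
        ∃ e : C, ∃ p q : dom α, e.1 = s(p, q) ∧ p.1 = z.1.1 ∧ q.1 = z.1.2 := by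
      rintro ⟨⟨p, q⟩, ⟨hp, hr⟩, hq⟩ hpos
      obtain ⟨-, hqd⟩ := mem_dom_of_bondStrength_pos hpos
      have hC : s((⟨p, hp⟩ : dom α), (⟨q, hqd⟩ : dom α)) ∈ C := by
        by_contra hC
        refine hq ⟨hqd, hr.trans (SimpleGraph.Adj.reachable ?_)⟩
        rw [SimpleGraph.deleteEdges_adj]
        exact ⟨hpos, hC⟩
      exact ⟨⟨_, hC⟩, _, _, rfl, rfl, rfl⟩
    let g : {z : (ℤ × ℤ) × (ℤ × ℤ) | z.1 ∈ S ∧ z.2 ∉ S} → ℝ≥0∞ :=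
      fun z => (bondStrength α z.1.1 z.1.2 : ℝ≥0∞)
    change ∑' z, g z ≤ _
    rw [← tsum_subtype_support g]
    have hsupp' : ∀ z : Function.support g,
        ∃ e : C, ∃ p q : dom α, e.1 = s(p, q) ∧ p.1 = z.1.1.1 ∧ q.1 = z.1.1.2 := by
      intro z
      refine hsupp z.1 ?_
      have := z.2
      simp only [g, Function.mem_support, ne_eq, Nat.cast_eq_zero] at this
      omega
    choose f hf using hsupp'
    have hinj : Function.Injective f := by
      intro z z' hzz
      obtain ⟨p, q, h1, hp, hq⟩ := hf z
      obtain ⟨p', q', h1', hp', hq'⟩ := hf z'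
      rw [hzz, h1', Sym2.eq_iff] at h1
      refine Subtype.ext (Subtype.ext (Prod.ext ?_ ?_))
      · rcases h1 with ⟨h1, -⟩ | ⟨h1, h2⟩
        · rw [← hp, ← hp', h1]
        · exact absurd (by rw [← hq, ← h1, hp']; exact z'.1.2.1 : z.1.1.2 ∈ S) z.1.2.2
      · rcases h1 with ⟨-, h1⟩ | ⟨h1, h2⟩
        · rw [← hq, ← hq', h1]
        · exact absurd (by rw [← hq, ← h1, hp']; exact z'.1.2.1 : z.1.1.2 ∈ S) z.1.2.2
    refine le_trans (le_of_eq (tsum_congr fun z => ?_))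
      (ENNReal.tsum_comp_le_tsum_of_injective hinj _)
    obtain ⟨p, q, h1, hp, hq⟩ := hf z
    rw [h1]
    change (bondStrength α z.1.1.1 z.1.1.2 : ℝ≥0∞) = (bondStrength α p.1 q.1 : ℝ≥0∞)
    rw [hp, hq]

/-- The total strength with which the tile at `p` interacts with its neighbours. -/
noncomputable def bindStrength (α : Config A) (p : ℤ × ℤ) : ℕ := ∑ d : Dir, sideStrength α p d

theorem tsum_bondStrength (α : Config A) (p : ℤ × ℤ) :
    ∑' q, (bondStrength α p q : ℝ≥0∞) = bindStrength α p := by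
  unfold bondStrength bindStrength
  push_cast
  rw [Summable.tsum_finsetSum fun _ _ => ENNReal.summable]
  refine Finset.sum_congr rfl fun d _ => ?_
  rw [tsum_eq_single (p + d.vec)]
  · simp
  · intro q hq
    simp [hq]

/-- The cut around a set that contains a single occupied position weighs as much as the bonds of
that tile. -/
theorem cutWeight_eq_of_inter_eq_singleton {α : Config A} {S : Set (ℤ × ℤ)} {p : ℤ × ℤ}
    (h : dom α ∩ S = {p}) : cutWeight α S = bindStrength α p := by
  have hp : p ∈ dom α ∩ S := by rw [h]; rfl
  unfold cutWeight
  rw [ENNReal.tsum_prod', tsum_eq_single p]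
  · rw [← tsum_bondStrength]
    refine tsum_congr fun q => ?_
    by_cases hq : q ∈ S
    · rw [Set.indicator_of_notMem (fun hh => hh.2 hq)]
      by_contra hne
      have hpos : 0 < bondStrength α p q := by
        rcases Nat.eq_zero_or_pos (bondStrength α p q) with h0 | h0
        · simp [h0] at hne
        · exact h0
      have hq' : q ∈ dom α ∩ S := ⟨(mem_dom_of_bondStrength_pos hpos).2, hq⟩
      rw [h] at hq'
      rw [Set.mem_singleton_iff.1 hq', bondStrength_self] at hpos
      exact lt_irrefl _ hpos
    · rw [Set.indicator_of_mem (show (p, q) ∈ {z : (ℤ × ℤ) × (ℤ × ℤ) | z.1 ∈ S ∧ z.2 ∉ S} from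
        ⟨hp.2, hq⟩)]
  · intro x hx
    refine ENNReal.tsum_eq_zero.2 fun q => ?_
    by_cases hxS : x ∈ S
    · have hxd : x ∉ dom α := fun hxd => hx (by
        have : x ∈ dom α ∩ S := ⟨hxd, hxS⟩
        rwa [h] at this)
      rw [Set.indicator_apply_eq_zero]
      intro _
      by_contra hne
      refine hxd (mem_dom_of_bondStrength_pos (q := q) ?_).1
      rcases Nat.eq_zero_or_pos (bondStrength α x q) with h0 | h0
      · simp [h0] at hne
      · exact h0
    · exact Set.indicator_of_notMem (fun hh => hxS hh.1) _

/-! ### Attaching single tiles -/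

theorem dom_update (α : Config A) (p : ℤ × ℤ) (t : TileType A) :
    dom (Function.update α p (some t)) = insert p (dom α) := by
  ext q
  by_cases h : q = p
  · subst h; simp [mem_dom]
  · simp [mem_dom, h]

theorem subassembly_update {α : Config A} {p : ℤ × ℤ} (hp : p ∉ dom α) (t : TileType A) :
    Subassembly α (Function.update α p (some t)) := by
  refine ⟨by rw [dom_update]; exact Set.subset_insert _ _, fun q hq => ?_⟩
  rw [Function.update_of_ne]
  rintro rfl
  exact hp hq

theorem grid_adj_add_vec (p : ℤ × ℤ) (d : Dir) : grid.Adj p (p + d.vec) := by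
  cases d <;> simp [grid, Dir.vec]

theorem exists_vec_of_grid_adj {p q : ℤ × ℤ} (h : grid.Adj p q) : ∃ d : Dir, q = p + d.vec := by
  have h' : |p.1 - q.1| + |p.2 - q.2| = 1 := h
  have h1 := abs_nonneg (p.1 - q.1)
  have h2 := abs_nonneg (p.2 - q.2)
  rcases (show |p.1 - q.1| = 1 ∧ |p.2 - q.2| = 0 ∨ |p.1 - q.1| = 0 ∧ |p.2 - q.2| = 1 by omega) with
    ⟨ha, hb⟩ | ⟨ha, hb⟩
  · rw [abs_eq_zero] at hb
    rcases (abs_eq (by norm_num)).1 ha with ha | ha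
    · exact ⟨.W, Prod.ext (by simp [Dir.vec]; omega) (by simp [Dir.vec]; omega)⟩
    · exact ⟨.E, Prod.ext (by simp [Dir.vec]; omega) (by simp [Dir.vec]; omega)⟩
  · rw [abs_eq_zero] at ha
    rcases (abs_eq (by norm_num)).1 hb with hb | hb
    · exact ⟨.S, Prod.ext (by simp [Dir.vec]; omega) (by simp [Dir.vec]; omega)⟩
    · exact ⟨.N, Prod.ext (by simp [Dir.vec]; omega) (by simp [Dir.vec]; omega)⟩

theorem connected_insert {V : Set (ℤ × ℤ)} (hV : (fullGridGraph V).Connected) {p q : ℤ × ℤ}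
    (hq : q ∈ V) (h : grid.Adj p q) : (fullGridGraph (insert p V)).Connected := by
  have hsub : V ⊆ insert p V := Set.subset_insert _ _
  have hmap : ∀ x : V, (fullGridGraph (insert p V)).Reachable ⟨q, hsub hq⟩ ⟨x.1, hsub x.2⟩ := by
    intro x
    exact (hV.preconnected ⟨q, hq⟩ x).map
      (⟨fun y => ⟨y.1, hsub y.2⟩, fun h => h⟩ : fullGridGraph V →g fullGridGraph (insert p V))
  rw [SimpleGraph.connected_iff_exists_forall_reachable]
  refine ⟨⟨q, hsub hq⟩, ?_⟩
  rintro ⟨x, rfl | hx⟩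
  · exact SimpleGraph.Adj.reachable (show grid.Adj q x from h.symm)
  · exact hmap ⟨x, hx⟩

namespace TAS

variable (𝒯 : TAS A)

/-- A tile that binds to an assembly with strength at least the temperature may be attached. -/
theorem step_update {α : Config A} (hα : IsAssembly 𝒯.tiles α) (hs : IsStable 𝒯.temp α)
    {p : ℤ × ℤ} {t : TileType A} (ht : t ∈ 𝒯.tiles) (hp : p ∉ dom α)
    (hb : 𝒯.temp ≤ bindStrength (Function.update α p (some t)) p) :
    𝒯.Step α (Function.update α p (some t)) := by
  set β := Function.update α p (some t) with hβ
  have hsub : Subassembly α β := subassembly_update hp t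
  have hdom : dom β = insert p (dom α) := dom_update α p t
  refine ⟨⟨hα, hs⟩, ⟨⟨?_, ?_, ?_⟩, ?_⟩, hsub, ?_⟩
  · intro q u hq
    by_cases hqp : q = p
    · subst hqp
      simp only [hβ, Function.update_self, Option.some.injEq] at hq
      exact hq ▸ ht
    · rw [hβ, Function.update_of_ne hqp] at hq
      exact hα.1 q u hq
  · exact ⟨p, by rw [hdom]; exact Set.mem_insert _ _⟩
  · have h0 : bindStrength β p ≠ 0 := by have := 𝒯.temp_pos; omega
    obtain ⟨d, -, hd⟩ := Finset.exists_ne_zero_of_sum_ne_zero h0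
    have hq := (mem_dom_of_sideStrength_pos (Nat.pos_of_ne_zero hd)).2
    rw [hdom] at hq ⊢
    have hadj := grid_adj_add_vec p d
    exact connected_insert hα.2.2 (Set.mem_of_mem_insert_of_ne hq hadj.ne') hadj
  · rw [isStable_iff] at hs ⊢
    intro S h1 h2
    by_cases h1' : (dom α ∩ S).Nonempty
    · by_cases h2' : (dom α \ S).Nonempty
      · exact (hs S h1' h2').trans (hsub.cutWeight_le S)
      · have hS : dom β ∩ Sᶜ = {p} := by
          refine Set.Nonempty.subset_singleton_iff h2 |>.1 ?_
          rintro x ⟨hx, hxS⟩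
          rw [hdom] at hx
          refine hx.resolve_right fun hx => h2' ⟨x, hx, hxS⟩
        rw [← cutWeight_compl, cutWeight_eq_of_inter_eq_singleton hS]
        exact_mod_cast hb
    · have hS : dom β ∩ S = {p} := by
        refine Set.Nonempty.subset_singleton_iff h1 |>.1 ?_
        rintro x ⟨hx, hxS⟩
        rw [hdom] at hx
        refine hx.resolve_right fun hx => h1' ⟨x, hx, hxS⟩
      rw [cutWeight_eq_of_inter_eq_singleton hS]
      exact_mod_cast hb
  · rw [hdom, Set.insert_sdiff_of_notMem _ hp]
    simp

theorem Step.exists_update {𝒯 : TAS A} {α β : Config A} (h : 𝒯.Step α β) :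
    ∃ p t, p ∉ dom α ∧ t ∈ 𝒯.tiles ∧ β = Function.update α p (some t) ∧
      𝒯.temp ≤ bindStrength β p := by
  obtain ⟨⟨hα, -⟩, ⟨hβ, hs⟩, hsub, hcard⟩ := h
  obtain ⟨p, hp⟩ := Set.encard_eq_one.1 hcard
  have hpm : p ∈ dom β \ dom α := by rw [hp]; rfl
  obtain ⟨t, ht⟩ := Option.ne_none_iff_exists'.1 (mem_dom.1 hpm.1)
  refine ⟨p, t, hpm.2, hβ.1 p t ht, ?_, ?_⟩
  · ext1 q
    by_cases hq : q = p
    · subst hq; simp [ht]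
    · rw [Function.update_of_ne hq]
      by_cases hqα : q ∈ dom α
      · exact hsub.apply_eq hqα
      · have : q ∉ dom β := fun hqβ => hq (by
          have : q ∈ dom β \ dom α := ⟨hqβ, hqα⟩
          rwa [hp] at this)
        rw [notMem_dom.1 hqα, notMem_dom.1 this]
  · rw [isStable_iff] at hs
    have hS : dom β ∩ {p} = {p} := Set.inter_eq_right.2 (Set.singleton_subset_iff.2 hpm.1)
    have := hs {p} (by rw [hS]; exact Set.singleton_nonempty p) ?_
    · rw [cutWeight_eq_of_inter_eq_singleton hS] at this
      exact_mod_cast this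
    · obtain ⟨x, hx⟩ := hα.2.1
      exact ⟨x, hsub.1 hx, fun hxp => hpm.2 (hxp ▸ hx)⟩

end TAS

/-! ### Limits of growing sequences of configurations -/

theorem subassembly_of_le {a : ℕ → Config A} (ha : ∀ i, Subassembly (a i) (a (i + 1)))
    {i j : ℕ} (hij : i ≤ j) : Subassembly (a i) (a j) := by
  induction j, hij using Nat.le_induction with
  | base => exact Subassembly.refl _
  | succ j _ ih => exact ih.trans (ha j)

open Classical in
/-- The union of a growing sequence of configurations. -/
noncomputable def limit (a : ℕ → Config A) : Config A := fun p =>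
  if h : ∃ i, p ∈ dom (a i) then a h.choose p else none

theorem limit_apply {a : ℕ → Config A} (ha : ∀ i, Subassembly (a i) (a (i + 1))) {i : ℕ}
    {p : ℤ × ℤ} (hp : p ∈ dom (a i)) : limit a p = a i p := by
  have h : ∃ i, p ∈ dom (a i) := ⟨i, hp⟩
  rw [limit, dif_pos h]
  rcases le_total i h.choose with hle | hle
  · exact (subassembly_of_le ha hle).apply_eq hp
  · exact ((subassembly_of_le ha hle).apply_eq h.choose_spec).symm

theorem dom_limit {a : ℕ → Config A} (ha : ∀ i, Subassembly (a i) (a (i + 1))) :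
    dom (limit a) = ⋃ i, dom (a i) := by
  ext p
  rw [Set.mem_iUnion]
  by_cases h : ∃ i, p ∈ dom (a i)
  · obtain ⟨i, hi⟩ := h
    refine ⟨fun _ => ⟨i, hi⟩, fun _ => ?_⟩
    rw [mem_dom, limit_apply ha hi]
    exact hi
  · refine ⟨fun hp => absurd ?_ (mem_dom.1 hp), fun h' => absurd h' h⟩
    rw [limit, dif_neg h]

theorem subassembly_limit {a : ℕ → Config A} (ha : ∀ i, Subassembly (a i) (a (i + 1))) (i : ℕ) :
    Subassembly (a i) (limit a) :=
  ⟨by rw [dom_limit ha]; exact Set.subset_iUnion (fun i => dom (a i)) i,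
    fun _ hp => (limit_apply ha hp).symm⟩

theorem isStable_limit {a : ℕ → Config A} (ha : ∀ i, Subassembly (a i) (a (i + 1))) {τ : ℕ}
    (hs : ∀ i, IsStable τ (a i)) : IsStable τ (limit a) := by
  rw [isStable_iff]
  rintro S ⟨x, hx, hxS⟩ ⟨y, hy, hyS⟩
  rw [dom_limit ha, Set.mem_iUnion] at hx hy
  obtain ⟨i, hi⟩ := hx
  obtain ⟨j, hj⟩ := hy
  have hx' := (subassembly_of_le ha (le_max_left i j)).1 hi
  have hy' := (subassembly_of_le ha (le_max_right i j)).1 hj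
  exact (isStable_iff.1 (hs (max i j)) S ⟨x, hx', hxS⟩ ⟨y, hy', hyS⟩).trans
    ((subassembly_limit ha _).cutWeight_le S)

/-! ### Every reachable assembly grows into a terminal one -/

namespace TAS

variable {𝒯 : TAS A}

/-- `γ` is obtained from the seed by finitely many single-tile attachments. -/
def Reachable (𝒯 : TAS A) (γ : Config A) : Prop := Relation.ReflTransGen 𝒯.Step 𝒯.seed γ

theorem Reachable.isAssembly {γ : Config A} (h : 𝒯.Reachable γ) :
    IsAssembly 𝒯.tiles γ ∧ IsStable 𝒯.temp γ := by
  induction h with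
  | refl => exact ⟨𝒯.seed_assembly, 𝒯.seed_stable⟩
  | tail _ hs _ => exact hs.2.1

theorem Reachable.exists_seq {γ : Config A} (h : 𝒯.Reachable γ) :
    ∃ (n : ℕ) (s : ℕ → Config A), s 0 = 𝒯.seed ∧ s n = γ ∧ ∀ i < n, 𝒯.Step (s i) (s (i + 1)) := by
  induction h with
  | refl => exact ⟨0, fun _ => 𝒯.seed, rfl, rfl, by simp⟩
  | @tail β γ _ hs ih =>
    obtain ⟨n, s, h0, hn, hstep⟩ := ih
    refine ⟨n + 1, fun i => if i ≤ n then s i else γ, by simp [h0], by simp, fun i hi => ?_⟩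
    rcases (Nat.lt_succ_iff.1 hi).lt_or_eq with hi | rfl
    · simp only [hi.le, if_true, Nat.succ_le_of_lt hi]
      exact hstep i hi
    · simp only [le_refl, if_true, hn, Nat.not_succ_le_self, if_false]
      exact hs

theorem mem_frontier {α : Config A} {p : ℤ × ℤ} (h : p ∈ 𝒯.frontier α) :
    p ∉ dom α ∧ ∃ t ∈ 𝒯.tiles, 𝒯.temp ≤ bindStrength (Function.update α p (some t)) p := by
  obtain ⟨β, hs, hpβ, hpα⟩ := h
  obtain ⟨q, t, hq, ht, rfl, hb⟩ := hs.exists_update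
  rw [dom_update] at hpβ
  obtain rfl := hpβ.resolve_right hpα
  exact ⟨hpα, t, ht, hb⟩

theorem mem_frontier_of_bindStrength {α : Config A} (hα : IsAssembly 𝒯.tiles α)
    (hs : IsStable 𝒯.temp α) {p : ℤ × ℤ} {t : TileType A} (ht : t ∈ 𝒯.tiles) (hp : p ∉ dom α)
    (hb : 𝒯.temp ≤ bindStrength (Function.update α p (some t)) p) : p ∈ 𝒯.frontier α :=
  ⟨_, 𝒯.step_update hα hs ht hp hb, by rw [dom_update]; exact Set.mem_insert _ _, hp⟩

theorem encard_of_steps {a : ℕ → Config A} {n : ℕ} (h : ∀ i < n, 𝒯.Step (a i) (a (i + 1))) :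
    Subassembly (a 0) (a n) ∧ (dom (a n) \ dom (a 0)).encard = n := by
  induction n with
  | zero => exact ⟨Subassembly.refl _, by simp⟩
  | succ n ih =>
    obtain ⟨hsub, hcard⟩ := ih fun i hi => h i (by omega)
    obtain ⟨-, -, hsub', hcard'⟩ := h n (by omega)
    refine ⟨hsub.trans hsub', ?_⟩
    have : dom (a (n + 1)) \ dom (a 0) =
        (dom (a (n + 1)) \ dom (a n)) ∪ (dom (a n) \ dom (a 0)) := by
      ext p
      have h1 := @hsub.1 p
      have h2 := @hsub'.1 p
      simp only [Set.mem_sdiff, Set.mem_union]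
      tauto
    rw [this, Set.encard_union_eq ?_, hcard, hcard']
    · push_cast; rw [add_comm]
    · exact Set.disjoint_left.2 fun p hp hp' => hp.2 hp'.1

/-- A greedy step: either nothing can attach, or the first position of the frontier (in a fixed
enumeration of the lattice) is filled. -/
theorem exists_greedy_step (γ : Config A) : ∃ γ', (𝒯.frontier γ = ∅ ∧ γ' = γ) ∨
    (𝒯.Step γ γ' ∧ ∃ p ∈ dom γ' \ dom γ, ∀ q ∈ 𝒯.frontier γ,
      Encodable.encode p ≤ Encodable.encode q) := by
  rcases (𝒯.frontier γ).eq_empty_or_nonempty with h | h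
  · exact ⟨γ, .inl ⟨h, rfl⟩⟩
  · let p := Function.argminOn (Encodable.encode : ℤ × ℤ → ℕ) (𝒯.frontier γ) h
    have hp : p ∈ 𝒯.frontier γ := Function.argminOn_mem _ _ h
    obtain ⟨β, hβ, hpβ⟩ := hp
    exact ⟨β, .inr ⟨hβ, p, hpβ, fun q hq => Function.argminOn_le _ _ hq⟩⟩

theorem mem_producible_of_steps {a : ℕ → Config A} {n : ℕ} (h0 : a 0 = 𝒯.seed)
    (h : ∀ i < n, 𝒯.Step (a i) (a (i + 1))) : a n ∈ 𝒯.producible := by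
  have hle : ∀ i : ℕ, (i : ℕ∞) < (n : ℕ∞) + 1 ↔ i ≤ n := fun i => by
    rw [← Nat.lt_succ_iff]; exact_mod_cast Iff.rfl
  have hsub : ∀ i ≤ n, Subassembly (a i) (a n) := by
    intro i hi
    obtain ⟨k, rfl⟩ := Nat.exists_eq_add_of_le hi
    exact (encard_of_steps (a := fun j => a (i + j)) (n := k)
      fun j hj => h (i + j) (by omega)).1
  refine ⟨n + 1, a, ?_, ⟨fun i hi => ?_, fun i hi => ?_⟩, h0, ?_, fun i hi => ?_⟩
  · rw [← h0, (encard_of_steps h).2]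
  · rcases ((hle i).1 hi).lt_or_eq with hi | rfl
    · exact (h i hi).1.1
    · cases i with
      | zero => rw [h0]; exact 𝒯.seed_assembly
      | succ j => exact (h j (by omega)).2.1.1
  · exact h i (by have := (hle _).1 hi; omega)
  · refine subset_antisymm (fun p hp => ?_) ?_
    · simp only [Set.mem_iUnion]
      exact ⟨n, (hle n).2 le_rfl, hp⟩
    · exact Set.iUnion₂_subset fun i hi => (hsub i ((hle i).1 hi)).1
  · exact hsub i ((hle i).1 hi)

theorem limit_mem_producible {a : ℕ → Config A} (h0 : a 0 = 𝒯.seed)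
    (h : ∀ i, 𝒯.Step (a i) (a (i + 1))) : limit a ∈ 𝒯.producible := by
  have ha : ∀ i, Subassembly (a i) (a (i + 1)) := fun i => (h i).2.2.1
  refine ⟨⊤, a, ?_, ⟨fun i _ => (h i).1.1, fun i _ => h i⟩, h0, ?_,
    fun i _ => subassembly_limit ha i⟩
  · have : (dom (limit a) \ dom 𝒯.seed).encard = ⊤ := by
      rw [ENat.eq_top_iff_forall_ge]
      intro n
      rw [← (encard_of_steps (a := a) (n := n) fun i _ => h i).2, h0]
      exact Set.encard_le_encard (Set.sdiff_subset_sdiff_left (subassembly_limit ha n).1)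
    rw [this]; rfl
  · simp [dom_limit ha]

/-- Greedy growth is fair: a position that stays on the frontier is eventually filled. Hence every
reachable assembly extends to a producible terminal one. -/
theorem Reachable.exists_terminal {γ : Config A} (h : 𝒯.Reachable γ) :
    ∃ α ∈ 𝒯.terminalAssemblies, dom γ ⊆ dom α := by
  obtain ⟨n, s, h0, hn, hs⟩ := h.exists_seq
  choose next hnext using exists_greedy_step (𝒯 := 𝒯)
  let a : ℕ → Config A := fun i => if i ≤ n then s i else next^[i - n] γ
  have ha0 : a 0 = 𝒯.seed := by simp [a, h0]
  have han : a n = γ := by simp [a, hn]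
  have halt : ∀ i < n, 𝒯.Step (a i) (a (i + 1)) := fun i hi => by
    simp only [a, hi.le, if_true, Nat.succ_le_of_lt hi]
    exact hs i hi
  have hage : ∀ i, n ≤ i → a (i + 1) = next (a i) := fun i hi => by
    rcases hi.lt_or_eq with hi' | rfl
    · simp only [a, show ¬ i ≤ n by omega, show ¬ i + 1 ≤ n by omega, if_false]
      rw [show i + 1 - n = (i - n) + 1 by omega, Function.iterate_succ_apply']
    · simp [a, hn]
  by_cases hfin : ∃ N, n ≤ N ∧ 𝒯.frontier (a N) = ∅
  · classical
    obtain ⟨hN, hemp⟩ := Nat.find_spec hfin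
    have hmin := fun i (hi : i < Nat.find hfin) => Nat.find_min hfin hi
    set N := Nat.find hfin
    have hstep : ∀ i < N, 𝒯.Step (a i) (a (i + 1)) := by
      intro i hi
      rcases lt_or_ge i n with hi' | hi'
      · exact halt i hi'
      · rw [hage i hi']
        rcases hnext (a i) with hh | hh
        · exact absurd ⟨hi', hh.1⟩ (hmin i hi)
        · exact hh.1
    refine ⟨a N, ⟨mem_producible_of_steps ha0 hstep, ?_, hemp⟩, ?_⟩
    · have : 𝒯.Reachable (a N) := by
        have hr : ∀ i ≤ N, 𝒯.Reachable (a i) := by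
          intro i
          induction i with
          | zero => intro _; rw [ha0]; exact Relation.ReflTransGen.refl
          | succ i ih => intro hi; exact (ih (by omega)).tail (hstep i (by omega))
        exact hr N le_rfl
      exact this.isAssembly.2
    · rw [← han]
      obtain ⟨k, hk⟩ := Nat.exists_eq_add_of_le hN
      have := (encard_of_steps (a := fun j => a (n + j)) (n := k)
        fun j hj => hstep (n + j) (by omega)).1.1
      rwa [← hk] at this
  · push Not at hfin
    have hstep' : ∀ i, n ≤ i → 𝒯.Step (a i) (a (i + 1)) ∧ ∃ p ∈ dom (a (i + 1)) \ dom (a i),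
        ∀ q ∈ 𝒯.frontier (a i), Encodable.encode p ≤ Encodable.encode q := by
      intro i hi
      rw [hage i hi]
      rcases hnext (a i) with hh | hh
      · exact absurd hh.1 (hfin i hi).ne_empty
      · exact hh
    have hstep : ∀ i, 𝒯.Step (a i) (a (i + 1)) := fun i => by
      rcases lt_or_ge i n with hi' | hi'
      · exact halt i hi'
      · exact (hstep' i hi').1
    have ha : ∀ i, Subassembly (a i) (a (i + 1)) := fun i => (hstep i).2.2.1
    refine ⟨limit a, ⟨limit_mem_producible ha0 hstep, isStable_limit ha fun i => (hstep i).1.2, ?_⟩,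
      by rw [← han]; exact (subassembly_limit ha n).1⟩
    rw [Set.eq_empty_iff_forall_notMem]
    intro p hp
    obtain ⟨hpd, t, ht, hb⟩ := mem_frontier hp
    -- from some stage on, all occupied neighbours of `p` are present
    have hnb : ∀ d : Dir, ∃ i, p + d.vec ∈ dom (limit a) → p + d.vec ∈ dom (a i) := by
      intro d
      by_cases hd : p + d.vec ∈ dom (limit a)
      · have hd' := hd
        rw [dom_limit ha, Set.mem_iUnion] at hd'
        exact ⟨hd'.choose, fun _ => hd'.choose_spec⟩
      · exact ⟨0, fun h => absurd h hd⟩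
    choose f hf using hnb
    let m := max n (Finset.univ.sup f)
    have hfront : ∀ i, m ≤ i → p ∈ 𝒯.frontier (a i) := by
      intro i hi
      have hpi : p ∉ dom (a i) := fun h => hpd ((subassembly_limit ha i).1 h)
      refine mem_frontier_of_bindStrength (hstep i).1.1 (hstep i).1.2 ht hpi (hb.trans ?_)
      refine Finset.sum_le_sum fun d _ => sideStrength_le fun hpos => ⟨by simp, ?_⟩
      have hne : p + d.vec ≠ p := (grid_adj_add_vec p d).ne'
      have hd := (mem_dom_of_sideStrength_pos hpos).2
      rw [dom_update] at hd
      have hd' := hf d (Set.mem_of_mem_insert_of_ne hd hne)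
      have hle : f d ≤ i :=
        (Finset.le_sup (f := f) (Finset.mem_univ d)).trans ((le_max_right _ _).trans hi)
      rw [Function.update_of_ne hne, Function.update_of_ne hne,
        limit_apply ha ((subassembly_of_le ha hle).1 hd')]
    have hnm : n ≤ m := le_max_left _ _
    choose x hx hmin using fun i => (hstep' (m + i) (by omega)).2
    have hinj : Function.Injective fun i => Encodable.encode (x i) := by
      refine Encodable.encode_injective.comp (Function.Injective.of_lt_imp_ne fun i j hij he => ?_)
      have h1 := (subassembly_of_le ha (show m + i + 1 ≤ m + j by omega)).1 (hx i).1
      rw [he] at h1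
      exact (hx j).2 h1
    exact Set.infinite_of_injective_forall_mem hinj
      (fun i => hmin i p (hfront (m + i) (by omega))) (Set.finite_Iic (Encodable.encode p))

theorem StrictlySelfAssembles.dom_subset {X : Set (ℤ × ℤ)} (h : 𝒯.StrictlySelfAssembles X)
    {γ : Config A} (hγ : 𝒯.Reachable γ) : dom γ ⊆ X := by
  obtain ⟨α, hα, hsub⟩ := hγ.exists_terminal
  rwa [h α hα] at hsub

/-- A system that strictly self-assembles an infinite set has an infinite assembly sequence that
fills this set. -/
theorem StrictlySelfAssembles.exists_seq {X : Set (ℤ × ℤ)} (h : 𝒯.StrictlySelfAssembles X)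
    (hX : X.Infinite) : ∃ a : ℕ → Config A, a 0 = 𝒯.seed ∧ (∀ i, 𝒯.Step (a i) (a (i + 1))) ∧
      ⋃ i, dom (a i) = X := by
  obtain ⟨α, hα, -⟩ := Reachable.exists_terminal (𝒯 := 𝒯) Relation.ReflTransGen.refl
  obtain ⟨k, a, hk, hseq, h0, hdom, -⟩ := hα.1
  rw [h α hα] at hk hdom
  have hk' : k = ⊤ := by
    rw [hk, Set.encard_eq_top_iff.2 (hX.sdiff 𝒯.seed_finite)]
    rfl
  subst hk'
  exact ⟨a, h0, fun i => hseq.2 i (ENat.natCast_lt_top _), by simpa using hdom.symm⟩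

end TAS

/-! ### Blocks of a scaled set -/

/-- The block of the `c`-scaled lattice in which a position lies. -/
def blk (c : ℕ) (p : ℤ × ℤ) : ℤ × ℤ := (p.1 / (c : ℤ), p.2 / (c : ℤ))

theorem mem_scaling {c : ℕ} {X : Set (ℤ × ℤ)} {p : ℤ × ℤ} : p ∈ scaling c X ↔ blk c p ∈ X :=
  Iff.rfl

theorem blk_add_smul {c : ℕ} (hc : 0 < c) (p v : ℤ × ℤ) :
    blk c (p + (c : ℤ) • v) = blk c p + v := by
  have hc' : (c : ℤ) ≠ 0 := by exact_mod_cast hc.ne'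
  ext <;> simp [blk, Int.add_mul_ediv_left _ _ hc']

theorem blk_sub_smul {c : ℕ} (hc : 0 < c) (p v : ℤ × ℤ) :
    blk c (p - (c : ℤ) • v) = blk c p - v := by
  rw [sub_eq_add_neg, ← smul_neg, blk_add_smul hc, ← sub_eq_add_neg]

theorem add_one_ediv {c : ℕ} (hc : 0 < c) (n : ℤ) :
    (n + 1) / (c : ℤ) = n / c ∨ (n + 1) / (c : ℤ) = n / c + 1 := by
  have hc' : (0 : ℤ) < c := by exact_mod_cast hc
  have h1 : n / (c : ℤ) ≤ (n + 1) / c := Int.ediv_le_ediv hc' (by omega)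
  have h2 : (n + 1) / (c : ℤ) ≤ (n + c) / c := Int.ediv_le_ediv hc' (by omega)
  rw [Int.add_ediv_of_dvd_right dvd_rfl, Int.ediv_self hc'.ne'] at h2
  omega

theorem blk_add_vec {c : ℕ} (hc : 0 < c) (p : ℤ × ℤ) (d : Dir) :
    blk c (p + d.vec) = blk c p ∨ grid.Adj (blk c p) (blk c (p + d.vec)) := by
  have aux : ∀ n : ℤ, (n + -1) / (c : ℤ) = n / c ∨ (n + -1) / (c : ℤ) = n / c - 1 := by
    intro n
    have := add_one_ediv hc (n + -1)
    rw [neg_add_cancel_right] at this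
    omega
  cases d <;> simp only [blk, Dir.vec, Prod.fst_add, Prod.snd_add, add_zero]
  · rcases add_one_ediv hc p.2 with h | h <;> simp [h, grid]
  · rcases add_one_ediv hc p.1 with h | h <;> simp [h, grid]
  · rcases aux p.2 with h | h <;> simp [h, grid]
  · rcases aux p.1 with h | h <;> simp [h, grid]

/-! ### Exchanging branches -/

/-- `C` is a part of `T` that is joined to the rest of `T` by a single edge of the grid, which
leads from `q ∈ C` in direction `d`. -/
structure IsBranch (T C : Set (ℤ × ℤ)) (q : ℤ × ℤ) (d : Dir) : Prop where
  subset : C ⊆ T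
  root_mem : q ∈ C
  exit_mem : q + d.vec ∈ T
  exit_notMem : q + d.vec ∉ C
  eq_of_adj : ∀ x ∈ C, ∀ y ∈ T, y ∉ C → grid.Adj x y → x = q ∧ y = q + d.vec

namespace TAS

variable {𝒯 : TAS A}

theorem Reachable.attach {γ β : Config A} (hγ : 𝒯.Reachable γ) {p p' : ℤ × ℤ} {t : TileType A}
    (ht : t ∈ 𝒯.tiles) (hp : p ∉ dom γ) (hβ : β p' = some t) (hb : 𝒯.temp ≤ bindStrength β p')
    (hn : ∀ d : Dir, p' + d.vec ∈ dom β → γ (p + d.vec) = β (p' + d.vec)) :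
    𝒯.Reachable (Function.update γ p (some t)) := by
  refine hγ.tail (𝒯.step_update hγ.isAssembly.1 hγ.isAssembly.2 ht hp (hb.trans ?_))
  refine Finset.sum_le_sum fun d _ => sideStrength_le fun hpos => ⟨by simp [hβ], ?_⟩
  rw [Function.update_of_ne (grid_adj_add_vec p d).ne']
  exact hn d (mem_dom_of_sideStrength_pos hpos).2

/-- `a` is an infinite assembly sequence of `𝒯` that fills `X`. -/
structure IsFillingSeq (𝒯 : TAS A) (X : Set (ℤ × ℤ)) (a : ℕ → Config A) : Prop where
  zero : a 0 = 𝒯.seed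
  step : ∀ i, 𝒯.Step (a i) (a (i + 1))
  iUnion_dom : ⋃ i, dom (a i) = X

/-- The stage of the sequence `a` at which the position `p` is filled. -/
noncomputable def arrival (a : ℕ → Config A) (p : ℤ × ℤ) : ℕ := sInf {i | p ∈ dom (a i)}

namespace IsFillingSeq

variable {X : Set (ℤ × ℤ)} {a : ℕ → Config A} (ha : 𝒯.IsFillingSeq X a)
include ha

theorem subassembly (i : ℕ) : Subassembly (a i) (a (i + 1)) := (ha.step i).2.2.1

theorem dom_subset (i : ℕ) : dom (a i) ⊆ X := by
  rw [← ha.iUnion_dom]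
  exact Set.subset_iUnion (fun i => dom (a i)) i

theorem mem_dom_iff {p : ℤ × ℤ} (hp : p ∈ X) (i : ℕ) : p ∈ dom (a i) ↔ arrival a p ≤ i := by
  rw [← ha.iUnion_dom, Set.mem_iUnion] at hp
  have hs : p ∈ dom (a (arrival a p)) := Nat.sInf_mem (s := {i | p ∈ dom (a i)}) hp
  exact ⟨fun h => Nat.sInf_le h, fun h => (subassembly_of_le ha.subassembly h).1 hs⟩

theorem apply_eq_limit {i : ℕ} {p : ℤ × ℤ} (hp : p ∈ dom (a i)) : a i p = limit a p :=
  (limit_apply ha.subassembly hp).symm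

/-- The tile that is attached at a given stage. -/
theorem exists_new (i : ℕ) : ∃ p t, p ∈ X ∧ p ∉ dom (a i) ∧ t ∈ 𝒯.tiles ∧
    a (i + 1) = Function.update (a i) p (some t) ∧ 𝒯.temp ≤ bindStrength (a (i + 1)) p ∧
    ∀ x ∈ X, arrival a x = i + 1 ↔ x = p := by
  obtain ⟨p, t, hp, ht, he, hb⟩ := (ha.step i).exists_update
  have hdom : dom (a (i + 1)) = insert p (dom (a i)) := by rw [he, dom_update]
  refine ⟨p, t, ha.dom_subset (i + 1) (by rw [hdom]; exact Set.mem_insert _ _), hp, ht, he, hb,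
    fun x hx => ?_⟩
  have h1 := ha.mem_dom_iff hx i
  have h2 := ha.mem_dom_iff hx (i + 1)
  rw [hdom] at h2
  constructor
  · intro h
    refine (h2.2 h.le).resolve_right fun h' => ?_
    have := h1.1 h'
    omega
  · rintro rfl
    have := h2.1 (Set.mem_insert _ _)
    have := mt h1.2 hp
    omega

end IsFillingSeq

/-- The information exchanged across the edge that leaves the block `q` in direction `d` agrees
with that at the block `q'`: the two pairs of blocks carry the same tiles, and these arrive in the
same relative order. -/
structure SameMovie (a : ℕ → Config A) (c : ℕ) (q q' : ℤ × ℤ) (d : Dir) : Prop where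
  tile : ∀ x, blk c x = q ∨ blk c x = q + d.vec →
    limit a x = limit a (x - (c : ℤ) • (q - q'))
  seed : ∀ x, blk c x = q ∨ blk c x = q + d.vec →
    (arrival a x = 0 ↔ arrival a (x - (c : ℤ) • (q - q')) = 0)
  order : ∀ x, blk c x = q ∨ blk c x = q + d.vec → ∀ y, blk c y = q ∨ blk c y = q + d.vec →
    (arrival a x ≤ arrival a y ↔
      arrival a (x - (c : ℤ) • (q - q')) ≤ arrival a (y - (c : ℤ) • (q - q')))

open Classical in
/-- The stage `α` outside the blocks of `C`, and, inside these blocks, the part of the stage `α'`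
in the blocks of `C'`, translated by `c • v`. -/
noncomputable def splice (c : ℕ) (C C' : Set (ℤ × ℤ)) (v : ℤ × ℤ) (α α' : Config A) : Config A :=
  fun x => if blk c x ∈ C then
    (if blk c x - v ∈ C' then α' (x - (c : ℤ) • v) else none) else α x

theorem splice_of_notMem {c : ℕ} {C C' : Set (ℤ × ℤ)} {v : ℤ × ℤ} {α α' : Config A} {x : ℤ × ℤ}
    (h : blk c x ∉ C) : splice c C C' v α α' x = α x := if_neg h

theorem splice_of_mem {c : ℕ} {C C' : Set (ℤ × ℤ)} {v : ℤ × ℤ} {α α' : Config A} {x : ℤ × ℤ}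
    (h : blk c x ∈ C) (h' : blk c x - v ∈ C') :
    splice c C C' v α α' x = α' (x - (c : ℤ) • v) := by
  rw [splice, if_pos h, if_pos h']

set_option maxHeartbeats 1000000 in
/-- If two branches have the same movie, the growth of the one can be replayed, translated, in the
place of the other, interleaved with the growth of the rest. A tile that left this place would
leave `T`. The stages `i` of the rest and `j` of the replayed branch are compatible if they fill
corresponding positions of the two pairs of blocks; the induction is on `i + j`. -/
theorem splice_reachable {T C C' : Set (ℤ × ℤ)} {c : ℕ} (hc : 0 < c) {q q' : ℤ × ℤ} {d : Dir}
    (hself : 𝒯.StrictlySelfAssembles (scaling c T)) {a : ℕ → Config A}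
    (ha : 𝒯.IsFillingSeq (scaling c T) a) (hC : IsBranch T C q d) (hC' : IsBranch T C' q' d)
    (hseed : ∀ x ∈ dom 𝒯.seed, blk c x ∉ C) (hseed' : ∀ x ∈ dom 𝒯.seed, blk c x ∉ C')
    (hm : SameMovie a c q q' d) (n : ℕ) : ∀ i j : ℕ, i + j = n →
    (∀ x, blk c x = q ∨ blk c x = q + d.vec →
      (arrival a x ≤ i ↔ arrival a (x - (c : ℤ) • (q - q')) ≤ j)) →
    𝒯.Reachable (splice c C C' (q - q') (a i) (a j)) ∧
      ∀ y ∈ dom (a j), blk c y ∈ C' → blk c y + (q - q') ∈ C := by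
  induction n using Nat.strong_induction_on with
  | _ n ih =>
  intro i j hij hcomp
  set v := q - q' with hv
  set u := (c : ℤ) • v with hu
  have hseq : ∀ x, blk c x = q ∨ blk c x = q + d.vec →
      (arrival a x = 0 ↔ arrival a (x - u) = 0) := hm.seed
  have hord : ∀ x, blk c x = q ∨ blk c x = q + d.vec → ∀ y, blk c y = q ∨ blk c y = q + d.vec →
      (arrival a x ≤ arrival a y ↔ arrival a (x - u) ≤ arrival a (y - u)) := hm.order
  have hblk : ∀ x, blk c (x - u) = blk c x - v := fun x => blk_sub_smul hc x v
  have hblk' : ∀ x, blk c (x + u) = blk c x + v := fun x => blk_add_smul hc x v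
  -- positions in the two blocks at the end of the branch belong to `T`
  have hwin : ∀ x, blk c x = q ∨ blk c x = q + d.vec → x ∈ scaling c T := by
    rintro x (h | h) <;> rw [mem_scaling, h]
    exacts [hC.subset hC.root_mem, hC.exit_mem]
  have hwin' : ∀ x, blk c x = q ∨ blk c x = q + d.vec → x - u ∈ scaling c T := by
    rintro x (h | h) <;> rw [mem_scaling, hblk, h, hv]
    · rw [sub_sub_cancel]; exact hC'.subset hC'.root_mem
    · rw [show q + d.vec - (q - q') = q' + d.vec by abel]; exact hC'.exit_mem
  -- neighbouring positions on different sides of the edge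
  have hcross : ∀ (x : ℤ × ℤ) (e : Dir), x ∈ scaling c T → x + e.vec ∈ scaling c T →
      (blk c x ∈ C → blk c (x + e.vec) ∉ C → blk c x = q ∧ blk c (x + e.vec) = q + d.vec) ∧
      (blk c x ∉ C → blk c (x + e.vec) ∈ C → blk c x = q + d.vec ∧ blk c (x + e.vec) = q) := by
    intro x e hx hy
    refine ⟨fun h1 h2 => ?_, fun h1 h2 => ?_⟩
    · rcases blk_add_vec hc x e with h | h
      · rw [h] at h2; exact absurd h1 h2
      · exact hC.eq_of_adj _ h1 _ hy h2 h
    · rcases blk_add_vec hc x e with h | h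
      · rw [h] at h2; exact absurd h2 h1
      · exact (hC.eq_of_adj _ h2 _ hx h1 h.symm).symm
  have hcross' : ∀ (x : ℤ × ℤ) (e : Dir), x + e.vec ∈ scaling c T → blk c x ∈ C' →
      blk c (x + e.vec) ∉ C' → blk c x = q' ∧ blk c (x + e.vec) = q' + d.vec := by
    intro x e hy h1 h2
    rcases blk_add_vec hc x e with h | h
    · rw [h] at h2; exact absurd h1 h2
    · exact hC'.eq_of_adj _ h1 _ hy h2 h
  have hneq : ∀ (x : ℤ × ℤ) (e : Dir), x + e.vec ≠ x := fun x e => (grid_adj_add_vec x e).ne'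
  by_cases hA : ∃ i', i = i' + 1 ∧ ∀ x, blk c x = q ∨ blk c x = q + d.vec → arrival a x ≠ i
  · -- the next outer tile lies off the two blocks
    obtain ⟨i, rfl, hno⟩ := hA
    obtain ⟨hr, hinc⟩ := ih (i + j) (by omega) i j rfl fun x hx => by
      rw [← hcomp x hx]
      have := hno x hx
      omega
    refine ⟨?_, hinc⟩
    obtain ⟨p, t, hpX, hp, ht, he, hb, htime⟩ := ha.exists_new i
    have hpw : ¬ (blk c p = q ∨ blk c p = q + d.vec) :=
      fun h => hno p h ((htime p hpX).2 rfl)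
    by_cases hpC : blk c p ∈ C
    · have : splice c C C' v (a (i + 1)) (a j) = splice c C C' v (a i) (a j) := by
        ext1 x
        by_cases hx : blk c x ∈ C
        · simp only [splice, if_pos hx]
        · rw [splice_of_notMem hx, splice_of_notMem hx, he, Function.update_of_ne]
          rintro rfl
          exact hx hpC
      rw [this]
      exact hr
    · have : splice c C C' v (a (i + 1)) (a j) =
          Function.update (splice c C C' v (a i) (a j)) p (some t) := by
        ext1 x
        by_cases hxp : x = p
        · subst hxp
          rw [splice_of_notMem hpC, he, Function.update_self, Function.update_self]
        · rw [Function.update_of_ne hxp]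
          by_cases hx : blk c x ∈ C
          · simp only [splice, if_pos hx]
          · rw [splice_of_notMem hx, splice_of_notMem hx, he, Function.update_of_ne hxp]
      rw [this]
      refine hr.attach ht ?_ (by rw [he]; simp) hb fun e hy => ?_
      · rwa [notMem_dom, splice_of_notMem hpC, ← notMem_dom]
      · have hyC : blk c (p + e.vec) ∉ C := fun h =>
          hpw (.inr ((hcross p e hpX (ha.dom_subset _ hy)).2 hpC h).1)
        rw [splice_of_notMem hyC, he, Function.update_of_ne (hneq p e)]
  by_cases hB : ∃ j', j = j' + 1 ∧ ∀ x, blk c x = q ∨ blk c x = q + d.vec → arrival a (x - u) ≠ j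
  · -- the next inner tile lies off the two blocks
    obtain ⟨j, rfl, hno⟩ := hB
    obtain ⟨hr, hinc⟩ := ih (i + j) (by omega) i j rfl fun x hx => by
      rw [hcomp x hx]
      have := hno x hx
      omega
    obtain ⟨p, t, hpX, hp, ht, he, hb, htime⟩ := ha.exists_new j
    have hdom : dom (a (j + 1)) = insert p (dom (a j)) := by rw [he, dom_update]
    have hpw : ¬ (blk c p = q' ∨ blk c p = q' + d.vec) := fun h => by
      refine hno (p + u) ?_ (by rw [add_sub_cancel_right]; exact (htime p hpX).2 rfl)
      rw [hblk', hv]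
      rcases h with h | h <;> rw [h]
      · left; abel
      · right; abel
    by_cases hpC : blk c p ∈ C'
    · -- all neighbours to which the tile binds lie in `C'`
      have hnbr : ∀ e : Dir, p + e.vec ∈ dom (a (j + 1)) → p + e.vec ∈ dom (a j) ∧
          blk c (p + e.vec) ∈ C' ∧ blk c (p + e.vec + u) ∈ C := by
        intro e hy
        have hyj : p + e.vec ∈ dom (a j) := by
          rw [hdom] at hy
          exact Set.mem_of_mem_insert_of_ne hy (hneq p e)
        have hyC : blk c (p + e.vec) ∈ C' := by
          by_contra h
          exact hpw (.inl (hcross' p e (ha.dom_subset _ hy) hpC h).1)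
        exact ⟨hyj, hyC, by rw [hblk']; exact hinc _ hyj hyC⟩
      have hr' : p + u ∉ dom (splice c C C' v (a i) (a j)) →
          𝒯.Reachable (Function.update (splice c C C' v (a i) (a j)) (p + u) (some t)) := by
        intro hpu
        refine hr.attach ht hpu (by rw [he]; simp) hb fun e hy => ?_
        obtain ⟨-, hyC, hyC'⟩ := hnbr e hy
        rw [add_right_comm, splice_of_mem hyC', he, Function.update_of_ne (hneq p e),
          ← hu, add_sub_cancel_right]
        rwa [hblk', add_sub_cancel_right]
      have hpuC : blk c (p + u) ∈ C := by
        by_contra hpuC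
        by_cases hT : p + u ∈ scaling c T
        · have h0 : bindStrength (a (j + 1)) p ≠ 0 := by have := 𝒯.temp_pos; omega
          obtain ⟨e, -, hpos⟩ := Finset.exists_ne_zero_of_sum_ne_zero h0
          obtain ⟨-, -, hyC'⟩ :=
            hnbr e (mem_dom_of_sideStrength_pos (Nat.pos_of_ne_zero hpos)).2
          rw [add_right_comm] at hyC'
          have := ((hcross (p + u) e hT (hC.subset hyC')).2 hpuC hyC').1
          rw [hblk', hv] at this
          refine hpw (.inr ?_)
          rw [← sub_eq_iff_eq_add.2 this.symm]
          abel
        · refine hT (hself.dom_subset (hr' ?_) (by rw [dom_update]; exact Set.mem_insert _ _))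
          rw [notMem_dom, splice_of_notMem hpuC, ← notMem_dom]
          exact fun h => hT (ha.dom_subset _ h)
      have hpuC' : blk c (p + u) - v ∈ C' := by rwa [hblk', add_sub_cancel_right]
      constructor
      · have : splice c C C' v (a i) (a (j + 1)) =
            Function.update (splice c C C' v (a i) (a j)) (p + u) (some t) := by
          ext1 x
          by_cases hxp : x = p + u
          · subst hxp
            rw [splice_of_mem hpuC hpuC', ← hu, he, add_sub_cancel_right, Function.update_self,
              Function.update_self]
          · rw [Function.update_of_ne hxp]
            simp only [splice, ← hu, he]
            rw [Function.update_of_ne fun h => hxp (sub_eq_iff_eq_add.1 h)]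
        rw [this]
        refine hr' ?_
        rwa [notMem_dom, splice_of_mem hpuC hpuC', ← hu, add_sub_cancel_right, ← notMem_dom]
      · intro y hy hyC
        rw [hdom] at hy
        rcases hy with rfl | hy
        · rwa [hblk'] at hpuC
        · exact hinc y hy hyC
    · constructor
      · have : splice c C C' v (a i) (a (j + 1)) = splice c C C' v (a i) (a j) := by
          ext1 x
          by_cases hx : blk c x ∈ C
          · by_cases hx' : blk c x - v ∈ C'
            · rw [splice_of_mem hx hx', splice_of_mem hx hx', he, Function.update_of_ne]
              rintro rfl
              rw [← hu, hblk] at hpC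
              exact hpC hx'
            · simp only [splice, if_pos hx, if_neg hx']
          · rw [splice_of_notMem hx, splice_of_notMem hx]
        rw [this]
        exact hr
      · intro y hy hyC
        rw [hdom] at hy
        rcases hy with rfl | hy
        · exact absurd hyC hpC
        · exact hinc y hy hyC
  -- otherwise both growths are at the start, or about to fill corresponding positions
  push Not at hA hB
  rcases i with _ | i
  · rcases j with _ | j
    · have hs : splice c C C' v (a 0) (a 0) = 𝒯.seed := by
        ext1 x
        rw [← ha.zero]
        by_cases hx : blk c x ∈ C
        · have h1 : a 0 x = none := by
            rw [ha.zero, ← notMem_dom]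
            exact fun h => hseed x h hx
          by_cases hx' : blk c x - v ∈ C'
          · rw [splice_of_mem hx hx', h1, ← notMem_dom, ← hu, ha.zero]
            intro h
            exact hseed' _ h (by rwa [hblk])
          · simp only [splice, if_pos hx, if_neg hx', h1]
        · rw [splice_of_notMem hx]
      refine ⟨by rw [hs]; exact Relation.ReflTransGen.refl, fun y hy hyC => ?_⟩
      rw [ha.zero] at hy
      exact absurd hyC (hseed' y hy)
    · obtain ⟨y, hy, hyj⟩ := hB j rfl
      have h1 := (hcomp y hy).2 hyj.le
      have h2 := (hseq y hy).1 (by omega)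
      omega
  obtain ⟨x, hx, hxi⟩ := hA i rfl
  have hxj := (hcomp x hx).1 hxi.le
  rcases j with _ | j
  · have := (hseq x hx).2 (by omega)
    omega
  obtain ⟨y, hy, hyj⟩ := hB j rfl
  have hxj' : arrival a (x - u) = j + 1 := by
    have h1 := (hord y hy x hx).1 (by have := (hcomp y hy).2 hyj.le; omega)
    omega
  obtain ⟨p, t, hpX, hp, ht, he, hb, htime⟩ := ha.exists_new i
  obtain rfl := (htime x (hwin x hx)).1 hxi
  obtain ⟨p', t', hpX', hp', ht', he', hb', htime'⟩ := ha.exists_new j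
  obtain rfl := (htime' _ (hwin' x hx)).1 hxj'
  have hdom' : dom (a (j + 1)) = insert (x - u) (dom (a j)) := by rw [he', dom_update]
  have hcomp' : ∀ y, blk c y = q ∨ blk c y = q + d.vec →
      (arrival a y ≤ i ↔ arrival a (y - u) ≤ j) := by
    intro y hy
    have h1 := hcomp y hy
    have h2 := htime y (hwin y hy)
    have h3 := htime' (y - u) (hwin' y hy)
    rw [sub_left_inj] at h3
    have h4 := h2.trans h3.symm
    omega
  obtain ⟨hr, hinc⟩ := ih (i + j) (by omega) i j rfl hcomp'
  -- the tiles in the two blocks agree at stages `i` and `j`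
  have hagree : ∀ y, blk c y = q ∨ blk c y = q + d.vec → y ∈ dom (a i) ∨ y - u ∈ dom (a j) →
      a i y = a j (y - u) := by
    intro y hy hd
    have h1 := ha.mem_dom_iff (hwin y hy) i
    have h2 := ha.mem_dom_iff (hwin' y hy) j
    have h3 := hcomp' y hy
    have hy1 : y ∈ dom (a i) := by tauto
    have hy2 : y - u ∈ dom (a j) := by tauto
    rw [ha.apply_eq_limit hy1, ha.apply_eq_limit hy2]
    exact hm.tile y hy
  have hnewC : splice c C C' v (a (i + 1)) (a (j + 1)) =
      Function.update (splice c C C' v (a i) (a j)) x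
        (splice c C C' v (a (i + 1)) (a (j + 1)) x) := by
    ext1 y
    by_cases hyx : y = x
    · subst hyx; rw [Function.update_self]
    · rw [Function.update_of_ne hyx]
      simp only [splice, ← hu, he, he']
      rw [Function.update_of_ne hyx, Function.update_of_ne fun h => hyx (sub_left_inj.1 h)]
  have hexit : q + d.vec - v ∉ C' := by
    rw [hv, show q + d.vec - (q - q') = q' + d.vec by abel]
    exact hC'.exit_notMem
  have hroot : q - v ∈ C' := by
    rw [hv, sub_sub_cancel]
    exact hC'.root_mem
  rcases hx with hx | hx
  · -- the position lies in the end block of the branch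
    have hxC : blk c x ∈ C := hx ▸ hC.root_mem
    have hxC' : blk c x - v ∈ C' := hx ▸ hroot
    have hval : splice c C C' v (a (i + 1)) (a (j + 1)) x = some t' := by
      rw [splice_of_mem hxC hxC', ← hu, he', Function.update_self]
    rw [hnewC, hval]
    constructor
    · refine hr.attach ht' ?_ (by rw [he']; simp) hb' fun e hy => ?_
      · rwa [notMem_dom, splice_of_mem hxC hxC', ← hu, ← notMem_dom]
      · have hyj : x - u + e.vec ∈ dom (a j) := by
          rw [hdom'] at hy
          exact Set.mem_of_mem_insert_of_ne hy (hneq _ e)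
        have hyu : x - u + e.vec = x + e.vec - u := by abel
        rw [he', Function.update_of_ne (hneq _ e)]
        by_cases hyC : blk c (x - u + e.vec) ∈ C'
        · have h1 := hinc _ hyj hyC
          rw [← hblk', show x - u + e.vec + u = x + e.vec by abel] at h1
          rw [hyu, hblk] at hyC
          rw [splice_of_mem h1 hyC, ← hu, hyu]
        · have h1 := (hcross' (x - u) e (ha.dom_subset _ hy) (by rwa [hblk]) hyC).2
          rw [hyu, hblk, hv] at h1
          have h2 : blk c (x + e.vec) = q + d.vec := by
            rw [sub_eq_iff_eq_add.1 h1]; abel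
          rw [splice_of_notMem (h2 ▸ hC.exit_notMem), hyu]
          exact hagree _ (.inr h2) (.inr (hyu ▸ hyj))
    · intro y hy hyC
      rw [hdom'] at hy
      rcases hy with rfl | hy
      · rwa [hblk, sub_add_cancel]
      · exact hinc y hy hyC
  · -- the position lies in the block next to the branch
    have hxC : blk c x ∉ C := hx ▸ hC.exit_notMem
    have hval : splice c C C' v (a (i + 1)) (a (j + 1)) x = some t := by
      rw [splice_of_notMem hxC, he, Function.update_self]
    rw [hnewC, hval]
    constructor
    · refine hr.attach ht ?_ (by rw [he]; simp) hb fun e hy => ?_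
      · rwa [notMem_dom, splice_of_notMem hxC, ← notMem_dom]
      · rw [he, dom_update] at hy
        have hyi := Set.mem_of_mem_insert_of_ne hy (hneq _ e)
        rw [he, Function.update_of_ne (hneq _ e)]
        by_cases hyC : blk c (x + e.vec) ∈ C
        · have h1 := ((hcross x e hpX (ha.dom_subset _ hyi)).2 hxC hyC).2
          rw [splice_of_mem hyC (h1 ▸ hroot), ← hu]
          exact (hagree _ (.inl h1) (.inl hyi)).symm
        · rw [splice_of_notMem hyC]
    · intro y hy hyC
      rw [hdom'] at hy
      rcases hy with rfl | hy
      · rw [hblk, hx] at hyC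
        exact absurd hyC hexit
      · exact hinc y hy hyC

/-- Of two branches with the same movie, each contains the translate of the other. -/
theorem branch_subset_of_sameMovie {T C C' : Set (ℤ × ℤ)} {c : ℕ} (hc : 0 < c) {q q' : ℤ × ℤ}
    {d : Dir} (hself : 𝒯.StrictlySelfAssembles (scaling c T)) {a : ℕ → Config A}
    (ha : 𝒯.IsFillingSeq (scaling c T) a) (hC : IsBranch T C q d) (hC' : IsBranch T C' q' d)
    (hseed : ∀ x ∈ dom 𝒯.seed, blk c x ∉ C) (hseed' : ∀ x ∈ dom 𝒯.seed, blk c x ∉ C')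
    (hm : SameMovie a c q q' d) : ∀ y ∈ C', y + (q - q') ∈ C := by
  intro y hy
  have hyb : blk c ((c : ℤ) • y) = y := by
    have := blk_add_smul hc 0 y
    rwa [zero_add, show blk c 0 = 0 by simp [blk], zero_add] at this
  have hyX : (c : ℤ) • y ∈ scaling c T := by
    rw [mem_scaling, hyb]
    exact hC'.subset hy
  set j := arrival a ((c : ℤ) • y) with hj
  -- the outer stage at which exactly the positions of the two blocks that correspond to those
  -- filled at stage `j` are filled
  obtain ⟨i, hi⟩ : ∃ i, ∀ x, blk c x = q ∨ blk c x = q + d.vec →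
      (arrival a x ≤ i ↔ arrival a (x - (c : ℤ) • (q - q')) ≤ j) := by
    by_cases hne : ∃ x, (blk c x = q ∨ blk c x = q + d.vec) ∧
        arrival a (x - (c : ℤ) • (q - q')) ≤ j
    · let W : Set (ℤ × ℤ) := {x | (blk c x = q ∨ blk c x = q + d.vec) ∧
        arrival a (x - (c : ℤ) • (q - q')) ≤ j}
      -- an element of `W` whose translate arrives last
      obtain ⟨z, hzW, hz⟩ : ∃ z ∈ W, ∀ x ∈ W, arrival a (x - (c : ℤ) • (q - q')) ≤
          arrival a (z - (c : ℤ) • (q - q')) := by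
        let S : Set ℕ := (fun x => arrival a (x - (c : ℤ) • (q - q'))) '' W
        have hS : S.Nonempty := Set.Nonempty.image _ hne
        have hSb : BddAbove S := ⟨j, by rintro _ ⟨x, hx, rfl⟩; exact hx.2⟩
        obtain ⟨z, hz, hzs⟩ := Nat.sSup_mem hS hSb
        exact ⟨z, hz, fun x hx => by rw [show arrival a (z - (c : ℤ) • (q - q')) = sSup S from hzs]; exact le_csSup hSb ⟨x, hx, rfl⟩⟩
      refine ⟨arrival a z, fun x hx => ?_⟩
      rw [hm.order x hx z hzW.1]
      exact ⟨fun h => h.trans hzW.2, fun h => hz x ⟨hx, h⟩⟩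
    · push Not at hne
      refine ⟨0, fun x hx => ⟨fun h => ?_, fun h => absurd h (hne x hx).not_ge⟩⟩
      have := (hm.seed x hx).1 (by omega)
      omega
  have := (splice_reachable hc hself ha hC hC' hseed hseed' hm _ i j rfl hi).2 _
    ((ha.mem_dom_iff hyX j).2 le_rfl) (by rwa [hyb])
  rwa [hyb] at this

end TAS

/-! ### Rooted grid trees and their cones -/

/-- `par` maps every point of the grid tree `T` to the next point on the way to the root `r`
(and fixes the root). -/
structure IsParent (T : Set (ℤ × ℤ)) (r : ℤ × ℤ) (par : ℤ × ℤ → ℤ × ℤ) : Prop where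
  root_mem : r ∈ T
  root : par r = r
  mem : ∀ x ∈ T, par x ∈ T
  adj : ∀ x ∈ T, x ≠ r → grid.Adj x (par x)
  reach : ∀ x ∈ T, ∃ n, par^[n] x = r
  edge : ∀ x ∈ T, ∀ y ∈ T, grid.Adj x y → par x = y ∨ par y = x

theorem exists_isParent {T : Set (ℤ × ℤ)} (hT : (fullGridGraph T).IsTree) {r : ℤ × ℤ}
    (hr : r ∈ T) : ∃ par, IsParent T r par := by
  classical
  have hpath := fun x : T => (hT.existsUnique_path x ⟨r, hr⟩).exists
  choose p hp using hpath
  have huniq : ∀ (x : T) (w : (fullGridGraph T).Walk x ⟨r, hr⟩), w.IsPath → w = p x :=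
    fun x w hw => (hT.existsUnique_path x ⟨r, hr⟩).unique hw (hp x)
  let par : ℤ × ℤ → ℤ × ℤ := fun x => if hx : x ∈ T then ((p ⟨x, hx⟩).snd : T).1 else x
  have hpar : ∀ x : T, par x.1 = ((p x).snd : T).1 := fun x => dif_pos x.2
  -- the path from a point other than the root starts with an edge and continues with the path
  -- from the next point
  have hstep : ∀ x : T, x.1 ≠ r → (fullGridGraph T).Adj x (p x).snd ∧ (p x).tail = p (p x).snd := by
    intro x hx
    have hnil : ¬ (p x).Nil := fun h => hx (congrArg Subtype.val h.eq)
    exact ⟨(p x).adj_snd hnil, huniq _ _ (hp x).tail⟩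
  refine ⟨par, hr, ?_, ?_, ?_, ?_, ?_⟩
  · have h := huniq ⟨r, hr⟩ SimpleGraph.Walk.nil SimpleGraph.Walk.IsPath.nil
    rw [hpar ⟨r, hr⟩, ← h]
    rfl
  · intro x hx
    rw [hpar ⟨x, hx⟩]
    exact (p ⟨x, hx⟩).snd.2
  · intro x hx hxr
    rw [hpar ⟨x, hx⟩]
    exact (hstep ⟨x, hx⟩ hxr).1
  · have key : ∀ (n : ℕ) (x : T), (p x).length = n → ∃ n, par^[n] x.1 = r := by
      intro n
      induction n with
      | zero =>
        intro x hx
        exact ⟨0, congrArg Subtype.val (SimpleGraph.Walk.eq_of_length_eq_zero hx)⟩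
      | succ n ih =>
        intro x hx
        by_cases hxr : x.1 = r
        · exact ⟨0, hxr⟩
        · have h1 := (hstep x hxr).2
          have hnil : ¬ (p x).Nil := fun h => hxr (congrArg Subtype.val h.eq)
          have h2 : (p (p x).snd).length = n := by
            rw [← h1]
            have := SimpleGraph.Walk.length_tail_add_one hnil
            omega
          obtain ⟨m, hm⟩ := ih _ h2
          exact ⟨m + 1, by rw [Function.iterate_succ_apply, hpar, hm]⟩
    intro x hx
    exact key _ ⟨x, hx⟩ rfl
  · intro x hx y hy hadj
    have hadj' : (fullGridGraph T).Adj ⟨x, hx⟩ ⟨y, hy⟩ := hadj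
    by_cases hmem : (⟨y, hy⟩ : T) ∈ (p ⟨x, hx⟩).support
    · left
      rw [hpar ⟨x, hx⟩, ← hT.isAcyclic.eq_snd_of_adj_start (hp ⟨x, hx⟩) hadj' hmem]
    · right
      have hcons := huniq ⟨y, hy⟩ (SimpleGraph.Walk.cons hadj'.symm (p ⟨x, hx⟩))
        ((SimpleGraph.Walk.cons_isPath_iff _ _).2 ⟨hp _, hmem⟩)
      rw [hpar ⟨y, hy⟩, ← hcons]
      simp

/-- The cone of `q`: the points of `T` that `q` separates from the root, and `q` itself. -/
def cone (T : Set (ℤ × ℤ)) (par : ℤ × ℤ → ℤ × ℤ) (q : ℤ × ℤ) : Set (ℤ × ℤ) :=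
  {x | x ∈ T ∧ ∃ n, par^[n] x = q}

namespace IsParent

variable {T : Set (ℤ × ℤ)} {r : ℤ × ℤ} {par : ℤ × ℤ → ℤ × ℤ}

theorem iterate_mem (h : IsParent T r par) {x : ℤ × ℤ} (hx : x ∈ T) (n : ℕ) : par^[n] x ∈ T := by
  induction n with
  | zero => exact hx
  | succ n ih => rw [Function.iterate_succ_apply']; exact h.mem _ ih

theorem iterate_root (h : IsParent T r par) (n : ℕ) : par^[n] r = r := Function.iterate_fixed h.root n

theorem eq_root_of_periodic (h : IsParent T r par) {x : ℤ × ℤ} (hx : x ∈ T) {n : ℕ} (hn : 0 < n)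
    (hp : par^[n] x = x) : x = r := by
  obtain ⟨k, hk⟩ := h.reach x hx
  have h1 : par^[n * k] x = x := Function.IsPeriodicPt.mul_const hp k
  have h2 : n * k = (n * k - k) + k := (Nat.sub_add_cancel (Nat.le_mul_of_pos_left k hn)).symm
  rw [h2, Function.iterate_add_apply, hk, h.iterate_root] at h1
  exact h1.symm

theorem self_mem_cone {q : ℤ × ℤ} (hq : q ∈ T) : q ∈ cone T par q := ⟨hq, 0, rfl⟩

theorem cone_subset_cone {q s : ℤ × ℤ} (h : s ∈ cone T par q) : cone T par s ⊆ cone T par q := by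
  rintro x ⟨hx, n, hn⟩
  obtain ⟨-, m, hm⟩ := h
  exact ⟨hx, m + n, by rw [Function.iterate_add_apply, hn, hm]⟩

/-- Two cones that meet are nested. -/
theorem mem_cone_or_mem_cone (h : IsParent T r par) {x q s : ℤ × ℤ} (hq : x ∈ cone T par q)
    (hs : x ∈ cone T par s) : s ∈ cone T par q ∨ q ∈ cone T par s := by
  obtain ⟨hx, n, rfl⟩ := hq
  obtain ⟨-, m, rfl⟩ := hs
  rcases le_total m n with hmn | hmn
  · refine .inl ⟨h.iterate_mem hx m, n - m, ?_⟩
    rw [← Function.iterate_add_apply, Nat.sub_add_cancel hmn]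
  · refine .inr ⟨h.iterate_mem hx n, m - n, ?_⟩
    rw [← Function.iterate_add_apply, Nat.sub_add_cancel hmn]

/-- A point has only finitely many ancestors. -/
theorem finite_ancestors (h : IsParent T r par) {x : ℤ × ℤ} (hx : x ∈ T) :
    {q | x ∈ cone T par q}.Finite := by
  obtain ⟨k, hk⟩ := h.reach x hx
  refine ((Set.finite_Iic k).image fun n => par^[n] x).subset ?_
  rintro q ⟨-, n, rfl⟩
  rcases le_total n k with hnk | hnk
  · exact ⟨n, hnk, rfl⟩
  · refine ⟨k, le_refl k, ?_⟩
    change par^[k] x = par^[n] x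
    rw [← Nat.sub_add_cancel hnk, Function.iterate_add_apply, hk, h.iterate_root]

theorem isBranch_cone (h : IsParent T r par) {q : ℤ × ℤ} (hq : q ∈ T) (hqr : q ≠ r) {d : Dir}
    (hd : par q = q + d.vec) : IsBranch T (cone T par q) q d where
  subset := fun _ hx => hx.1
  root_mem := self_mem_cone hq
  exit_mem := hd ▸ h.mem q hq
  exit_notMem := by
    rintro ⟨-, n, hn⟩
    rw [← hd, ← Function.iterate_succ_apply] at hn
    exact hqr (h.eq_root_of_periodic hq n.succ_pos hn)
  eq_of_adj := by
    rintro x ⟨hx, n, hn⟩ y hy hyC hadj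
    rcases h.edge x hx y hy hadj with hxy | hxy
    · cases n with
      | zero =>
        obtain rfl : x = q := hn
        exact ⟨rfl, by rw [← hxy, hd]⟩
      | succ n =>
        rw [Function.iterate_succ_apply, hxy] at hn
        exact absurd ⟨hy, n, hn⟩ hyC
    · exact absurd ⟨hy, n + 1, by rw [Function.iterate_succ_apply, hxy, hn]⟩ hyC

/-- Among the finitely many children of a point, one has infinitely many descendants in `P` if the
point has. -/
theorem exists_child (h : IsParent T r par) {P : Set (ℤ × ℤ)} {x : ℤ × ℤ}
    (hx : (cone T par x ∩ P).Infinite) :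
    ∃ y ∈ T, par y = x ∧ y ≠ r ∧ (cone T par y ∩ P).Infinite := by
  classical
  by_contra hcon
  push Not at hcon
  have hsub : cone T par x ∩ P ⊆ {x} ∪ ⋃ d : Dir,
      {z | z ∈ cone T par (x + d.vec) ∩ P ∧ x + d.vec ∈ T ∧ par (x + d.vec) = x ∧
        x + d.vec ≠ r} := by
    rintro z ⟨⟨hz, hn⟩, hzP⟩
    have h1 := Nat.find_spec hn
    have h2 := fun m => Nat.find_min hn (m := m)
    rcases hk : Nat.find hn with _ | k
    · rw [hk] at h1
      exact .inl h1
    · right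
      rw [hk] at h1 h2
      rw [Function.iterate_succ_apply'] at h1
      have hyx : par^[k] z ≠ x := h2 k (Nat.lt_succ_self k)
      have hyr : par^[k] z ≠ r := fun hr => hyx (by rw [hr, h.root] at h1; rw [hr, h1])
      obtain ⟨d, hd⟩ := exists_vec_of_grid_adj (h.adj _ (h.iterate_mem hz k) hyr).symm
      rw [h1] at hd
      refine Set.mem_iUnion.2 ⟨d, ⟨⟨hz, k, hd⟩, hzP⟩, ?_⟩
      rw [← hd]
      exact ⟨h.iterate_mem hz k, h1, hyr⟩
  refine hx (((Set.finite_singleton x).union (Set.finite_iUnion fun d => ?_)).subset hsub)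
  by_cases hd : x + d.vec ∈ T ∧ par (x + d.vec) = x ∧ x + d.vec ≠ r
  · have := hcon _ hd.1 hd.2.1 hd.2.2
    exact this.subset fun z hz => hz.1
  · convert Set.finite_empty
    exact Set.eq_empty_of_forall_notMem fun z hz => hd hz.2

/-- König's lemma, in the form of a ray of points that all have infinitely many descendants in the
given infinite set. -/
theorem exists_ray (h : IsParent T r par) {P : Set (ℤ × ℤ)} (hP : P.Infinite) (hPT : P ⊆ T) :
    ∃ x : ℕ → ℤ × ℤ, Function.Injective x ∧ (∀ n, x n ∈ T) ∧
      (∀ m n, m ≤ n → x n ∈ cone T par (x m)) ∧ ∀ n, (cone T par (x n) ∩ P).Infinite := by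
  have hr : (cone T par r ∩ P).Infinite := by
    rwa [Set.inter_eq_right.2]
    exact fun x hx => ⟨hPT hx, h.reach x (hPT hx)⟩
  let V := {x // x ∈ T ∧ (cone T par x ∩ P).Infinite}
  have hex : ∀ x : V, ∃ y : V, par y.1 = x.1 ∧ y.1 ≠ r := fun x => by
    obtain ⟨y, hy, h1, h2, h3⟩ := h.exists_child x.2.2
    exact ⟨⟨y, hy, h3⟩, h1, h2⟩
  choose f hf hfr using hex
  let x : ℕ → V := fun n => f^[n] ⟨r, h.root_mem, hr⟩
  have hs : ∀ n, x (n + 1) = f (x n) := fun n => Function.iterate_succ_apply' _ _ _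
  have hit : ∀ m n, par^[n] (x (m + n)).1 = (x m).1 := by
    intro m n
    induction n with
    | zero => rfl
    | succ n ih => rw [Function.iterate_succ_apply, ← add_assoc, hs, hf, ih]
  refine ⟨fun n => (x n).1, ?_, fun n => (x n).2.1, fun m n hmn => ?_, fun n => (x n).2.2⟩
  · refine Function.Injective.of_lt_imp_ne fun m n hmn heq => ?_
    obtain ⟨k, rfl⟩ := Nat.exists_eq_add_of_lt hmn
    have h1 := hit m (k + 1)
    change (x m).1 = (x (m + k + 1)).1 at heq
    rw [heq] at h1
    have h2 := h.eq_root_of_periodic (x (m + k + 1)).2.1 k.succ_pos h1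
    rw [hs] at h2
    exact hfr _ h2
  · obtain ⟨k, rfl⟩ := Nat.exists_eq_add_of_le hmn
    exact ⟨(x (m + k)).2.1, k, hit m k⟩

end IsParent

/-! ### Grid trees with finitely many types of cones -/

/-- The square of side `N` at the origin of the quadrant. -/
def box (N : ℕ) : Set (ℤ × ℤ) := Set.Ico (0 : ℤ) N ×ˢ Set.Ico (0 : ℤ) N

theorem finite_box (N : ℕ) : (box N).Finite := (Set.finite_Ico _ _).prod (Set.finite_Ico _ _)

/-- `X` has at most linearly many points in the square of side `N`. -/
def LinearGrowth (X : Set (ℤ × ℤ)) : Prop := ∃ k : ℕ, ∀ N : ℕ, 0 < N → (X ∩ box N).ncard ≤ k * N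

theorem LinearGrowth.mono {X Y : Set (ℤ × ℤ)} (hXY : X ⊆ Y) (h : LinearGrowth Y) :
    LinearGrowth X := by
  obtain ⟨k, hk⟩ := h
  exact ⟨k, fun N hN => (Set.ncard_le_ncard (Set.inter_subset_inter_left _ hXY)
    ((finite_box N).inter_of_right _)).trans (hk N hN)⟩

theorem LinearGrowth.union {X Y : Set (ℤ × ℤ)} (hX : LinearGrowth X) (hY : LinearGrowth Y) :
    LinearGrowth (X ∪ Y) := by
  obtain ⟨k, hk⟩ := hX
  obtain ⟨l, hl⟩ := hY
  refine ⟨k + l, fun N hN => ?_⟩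
  rw [Set.union_inter_distrib_right, add_mul]
  exact (Set.ncard_union_le _ _).trans (add_le_add (hk N hN) (hl N hN))

theorem LinearGrowth.of_finite {X : Set (ℤ × ℤ)} (hX : X.Finite) : LinearGrowth X :=
  ⟨X.ncard, fun _ hN => (Set.ncard_le_ncard Set.inter_subset_left hX).trans
    (Nat.le_mul_of_pos_right _ hN)⟩

theorem LinearGrowth.biUnion {ι : Type*} {Q : Set ι} (hQ : Q.Finite) {X : ι → Set (ℤ × ℤ)}
    (hX : ∀ q ∈ Q, LinearGrowth (X q)) : LinearGrowth (⋃ q ∈ Q, X q) := by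
  induction Q, hQ using Set.Finite.induction_on with
  | empty => simpa using LinearGrowth.of_finite Set.finite_empty
  | @insert q Q _ _ ih =>
    rw [Set.biUnion_insert]
    exact (hX q (Set.mem_insert _ _)).union (ih fun s hs => hX s (Set.mem_insert_of_mem _ hs))

/-- A descendant `q'` of `q` whose cone is the translate of the cone of `q`. -/
structure IsPeriod (T : Set (ℤ × ℤ)) (par : ℤ × ℤ → ℤ × ℤ) (q q' : ℤ × ℤ) : Prop where
  mem : q ∈ T
  ne : q' ≠ q
  mem_cone : q' ∈ cone T par q
  shift : ∀ y ∈ cone T par q, y + (q' - q) ∈ cone T par q'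
  unshift : ∀ y ∈ cone T par q', y + (q - q') ∈ cone T par q

namespace IsPeriod

variable {T : Set (ℤ × ℤ)} {r : ℤ × ℤ} {par : ℤ × ℤ → ℤ × ℤ} {q q' : ℤ × ℤ}

theorem shift_iterate (h : IsPeriod T par q q') {y : ℤ × ℤ} (hy : y ∈ cone T par q) (k : ℕ) :
    y + k • (q' - q) ∈ cone T par q ∧ y + (k + 1) • (q' - q) ∈ cone T par q' := by
  induction k with
  | zero => simpa using ⟨hy, h.shift y hy⟩
  | succ k ih =>
    have h1 := IsParent.cone_subset_cone h.mem_cone ih.2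
    refine ⟨h1, ?_⟩
    rw [succ_nsmul, ← add_assoc]
    exact h.shift _ h1

/-- If the cone of `q` contains a periodic cone that is disjoint from the cone of `q'`, then `T`
contains a lattice sector of dimension two. -/
theorem exists_sector {s s' : ℤ × ℤ} (h : IsPeriod T par q q') (h' : IsPeriod T par s s')
    (hs : s ∈ cone T par q) (hdisj : Disjoint (cone T par s) (cone T par q')) :
    (∀ k l : ℕ, s + k • (q' - q) + l • (s' - s) ∈ T) ∧
      Function.Injective fun z : ℕ × ℕ => s + z.1 • (q' - q) + z.2 • (s' - s) := by
  have hmem : ∀ l : ℕ, s + l • (s' - s) ∈ cone T par s :=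
    fun l => (h'.shift_iterate (IsParent.self_mem_cone h'.mem) l).1
  have hlt : ∀ k k' l l' : ℕ, k < k' →
      s + k • (q' - q) + l • (s' - s) ≠ s + k' • (q' - q) + l' • (s' - s) := by
    intro k k' l l' hk he
    obtain ⟨m, rfl⟩ := Nat.exists_eq_add_of_lt hk
    refine Set.disjoint_left.1 hdisj (hmem l) ?_
    have h1 := (h.shift_iterate (IsParent.cone_subset_cone hs (hmem l')) m).2
    convert h1 using 1
    rw [add_assoc k m 1, add_nsmul, add_right_comm] at he
    have h2 : s + l • (s' - s) + k • (q' - q) =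
        s + l' • (s' - s) + (m + 1) • (q' - q) + k • (q' - q) := by
      rw [he]; abel
    exact add_right_cancel h2
  refine ⟨fun k l => ?_, ?_⟩
  · rw [add_right_comm]
    exact (h.shift_iterate (IsParent.cone_subset_cone hs (hmem l)) k).1.1
  · rintro ⟨k, l⟩ ⟨k', l'⟩ he
    change s + k • (q' - q) + l • (s' - s) = s + k' • (q' - q) + l' • (s' - s) at he
    rcases lt_trichotomy k k' with hk | rfl | hk
    · exact absurd he (hlt k k' l l' hk)
    · have h1 := add_left_cancel he
      have hne : s' - s ≠ 0 := sub_ne_zero.2 h'.ne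
      rw [← natCast_zsmul, ← natCast_zsmul] at h1
      have h2 := smul_left_injective ℤ hne h1
      rw [Nat.cast_injective h2]
    · exact absurd he.symm (hlt k' k l' l hk)

/-- If only finitely many points lie between two periods, then the cone is contained in a strip
along its period. -/
theorem linearGrowth (h : IsPeriod T par q q') (hT : ∀ x ∈ T, 0 ≤ x.1 ∧ 0 ≤ x.2)
    (hfin : (cone T par q \ cone T par q').Finite) : LinearGrowth (cone T par q) := by
  set v := q' - q with hv
  have hcoord : ∀ k : ℕ, 0 ≤ q.1 + k * v.1 ∧ 0 ≤ q.2 + k * v.2 := fun k => by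
    have := hT _ (h.shift_iterate (IsParent.self_mem_cone h.mem) k).1.1
    simpa [hv] using this
  have hnn : ∀ a b : ℤ, (∀ k : ℕ, 0 ≤ a + k * b) → 0 ≤ b := by
    intro a b hab
    by_contra hb
    have h1 := hab (a.toNat + 1)
    have h2 := Int.self_le_toNat a
    push_cast at h1
    nlinarith
  have hv1 : 0 ≤ v.1 := hnn _ _ fun k => (hcoord k).1
  have hv2 : 0 ≤ v.2 := hnn _ _ fun k => (hcoord k).2
  have hv0 : 1 ≤ v.1 ∨ 1 ≤ v.2 := by
    by_contra hcon
    exact h.ne (sub_eq_zero.1 (Prod.ext (show v.1 = 0 by omega) (show v.2 = 0 by omega)))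
  refine ⟨(cone T par q \ cone T par q').ncard, fun N _ => ?_⟩
  have hsub : cone T par q ∩ box N ⊆ (fun z : (ℤ × ℤ) × ℕ => z.1 + z.2 • v) ''
      ((cone T par q \ cone T par q') ×ˢ Set.Iio N) := by
    rintro x ⟨hx, hxN⟩
    by_contra hcon
    -- otherwise one could walk back along the period for ever
    have hback : ∀ k ≤ N, x - k • v ∈ cone T par q := by
      intro k
      induction k with
      | zero => intro _; simpa using hx
      | succ k ih =>
        intro hk
        have h1 := ih (by omega)
        have h2 : x - k • v ∈ cone T par q' := by
          by_contra h2
          exact hcon ⟨(x - k • v, k), ⟨⟨h1, h2⟩, show k < N by omega⟩, by simp⟩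
        have h3 := h.unshift _ h2
        rwa [show x - k • v + (q - q') = x - (k + 1) • v by
          rw [succ_nsmul, hv]; abel] at h3
    have h1 : 0 ≤ x.1 - N * v.1 ∧ 0 ≤ x.2 - N * v.2 := by
      have := hT _ (hback N le_rfl).1
      simp only [Prod.fst_sub, Prod.snd_sub, Prod.smul_fst, Prod.smul_snd] at this
      simpa only [nsmul_eq_mul] using this
    obtain ⟨⟨-, h2⟩, ⟨-, h3⟩⟩ := hxN
    rcases hv0 with hv0 | hv0 <;> nlinarith
  calc (cone T par q ∩ box N).ncard
      ≤ ((fun z : (ℤ × ℤ) × ℕ => z.1 + z.2 • v) ''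
          ((cone T par q \ cone T par q') ×ˢ Set.Iio N)).ncard :=
        Set.ncard_le_ncard hsub ((hfin.prod (Set.finite_Iio N)).image _)
    _ ≤ ((cone T par q \ cone T par q') ×ˢ Set.Iio N).ncard :=
        Set.ncard_image_le (hfin.prod (Set.finite_Iio N))
    _ = (cone T par q \ cone T par q').ncard * N := by
        rw [Set.ncard_prod, Set.ncard_Iio_nat]

end IsPeriod

/-- Every infinite set of points of a tree with finitely many types of cones has infinitely many
points in a periodic cone, whose apex may be required to avoid a given finite set. -/
theorem IsParent.exists_isPeriod {T : Set (ℤ × ℤ)} {r : ℤ × ℤ} {par : ℤ × ℤ → ℤ × ℤ}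
    (h : IsParent T r par) {ι : Type*} [Finite ι] {E : Set (ℤ × ℤ)} (hE : E.Finite)
    (key : ℤ × ℤ → ι) (hkey : ∀ q ∈ T \ E, ∀ q' ∈ T \ E, key q = key q' →
      ∀ y ∈ cone T par q', y + (q - q') ∈ cone T par q)
    {P : Set (ℤ × ℤ)} (hP : P.Infinite) (hPT : P ⊆ T) {Z : Set (ℤ × ℤ)} (hZ : Z.Finite) :
    ∃ q q', IsPeriod T par q q' ∧ q ∉ Z ∧ (cone T par q ∩ P).Infinite := by
  obtain ⟨x, hinj, hxT, hcone, hinf⟩ := h.exists_ray hP hPT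
  have hfin : {n | x n ∈ E ∪ Z}.Finite := (hE.union hZ).preimage hinj.injOn
  obtain ⟨N, hN⟩ := hfin.bddAbove
  have hout : ∀ n, x (N + 1 + n) ∉ E ∪ Z := fun n hn => by
    have := hN hn
    omega
  obtain ⟨m, n, hmn, hk⟩ : ∃ m n, m < n ∧ key (x (N + 1 + m)) = key (x (N + 1 + n)) := by
    obtain ⟨m, n, hne, hk⟩ := Finite.exists_ne_map_eq_of_infinite fun n => key (x (N + 1 + n))
    rcases hne.lt_or_gt with hlt | hlt
    exacts [⟨m, n, hlt, hk⟩, ⟨n, m, hlt, hk.symm⟩]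
  have hm : x (N + 1 + m) ∈ T \ E := ⟨hxT _, fun h => hout m (.inl h)⟩
  have hn : x (N + 1 + n) ∈ T \ E := ⟨hxT _, fun h => hout n (.inl h)⟩
  exact ⟨x (N + 1 + m), x (N + 1 + n), ⟨hxT _, fun he => by have := hinj he; omega,
    hcone _ _ (by omega), hkey _ hn _ hm hk.symm, hkey _ hm _ hn hk⟩,
    fun h => hout m (.inr h), hinf _⟩

/-- A tree in the quadrant with finitely many types of cones contains a two-dimensional lattice
sector, or it grows linearly. -/
theorem IsParent.sector_or_linearGrowth {T : Set (ℤ × ℤ)} {r : ℤ × ℤ} {par : ℤ × ℤ → ℤ × ℤ}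
    (h : IsParent T r par) (hT : ∀ x ∈ T, 0 ≤ x.1 ∧ 0 ≤ x.2) {ι : Type*} [Finite ι]
    {E : Set (ℤ × ℤ)} (hE : E.Finite) (key : ℤ × ℤ → ι)
    (hkey : ∀ q ∈ T \ E, ∀ q' ∈ T \ E, key q = key q' →
      ∀ y ∈ cone T par q', y + (q - q') ∈ cone T par q) :
    (∃ s v w : ℤ × ℤ, (∀ k l : ℕ, s + k • v + l • w ∈ T) ∧
      Function.Injective fun z : ℕ × ℕ => s + z.1 • v + z.2 • w) ∨ LinearGrowth T := by
  by_contra hcon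
  push Not at hcon
  obtain ⟨hsec, hlin⟩ := hcon
  have hfin : ∀ q q', IsPeriod T par q q' → (cone T par q \ cone T par q').Finite := by
    intro q q' hq
    by_contra hinf
    obtain ⟨s, s', hs, hsZ, hsF⟩ := h.exists_isPeriod hE key hkey hinf (fun x hx => hx.1.1)
      (h.finite_ancestors hq.mem_cone.1)
    obtain ⟨z, hzs, hzq, hzq'⟩ := hsF.nonempty
    have hsq : s ∈ cone T par q := (h.mem_cone_or_mem_cone hzq hzs).resolve_right fun hh =>
      hsZ (IsParent.cone_subset_cone hh hq.mem_cone)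
    have hdisj : Disjoint (cone T par s) (cone T par q') := by
      rw [Set.disjoint_left]
      intro w hws hwq
      rcases h.mem_cone_or_mem_cone hws hwq with hh | hh
      · exact hsZ hh
      · exact hzq' (IsParent.cone_subset_cone hh hzs)
    obtain ⟨h1, h2⟩ := hq.exists_sector hs hsq hdisj
    exact hsec s _ _ h1 h2
  -- only finitely many points lie outside all periodic cones
  let S : Set (ℤ × ℤ) := {x | x ∈ T ∧ ∀ q q', IsPeriod T par q q' → q ≠ r → x ∉ cone T par q}
  have hS : S.Finite := by
    by_contra hinf
    obtain ⟨q, q', hq, hqr, hqS⟩ := h.exists_isPeriod hE key hkey hinf (fun x hx => hx.1)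
      (Set.finite_singleton r)
    obtain ⟨z, hzq, hzS⟩ := hqS.nonempty
    exact hzS.2 q q' hq hqr hzq
  have hrS : r ∈ S := ⟨h.root_mem, fun q q' _ hqr hr => hqr (by
    obtain ⟨-, n, hn⟩ := hr
    rw [← hn, h.iterate_root])⟩
  let Q : Set (ℤ × ℤ) := {q | (∃ q', IsPeriod T par q q') ∧ q ≠ r ∧ par q ∈ S}
  have hQ : Q.Finite := by
    refine (Set.Finite.image2 (fun x d => x + Dir.vec d) hS (Set.finite_univ)).subset ?_
    rintro q ⟨⟨q', hq⟩, hqr, hqS⟩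
    obtain ⟨d, hd⟩ := exists_vec_of_grid_adj (h.adj q hq.mem hqr).symm
    exact ⟨_, hqS, d, trivial, hd.symm⟩
  have hcov : T ⊆ S ∪ ⋃ q ∈ Q, cone T par q := by
    classical
    intro x hx
    by_cases hxS : x ∈ S
    · exact .inl hxS
    right
    have hex : ∃ n, par^[n] x ∈ S := by
      obtain ⟨n, hn⟩ := h.reach x hx
      exact ⟨n, hn ▸ hrS⟩
    have h1 := Nat.find_spec hex
    have h2 := fun m => Nat.find_min hex (m := m)
    rcases hk : Nat.find hex with _ | k
    · rw [hk] at h1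
      exact absurd h1 hxS
    · rw [hk] at h1 h2
      rw [Function.iterate_succ_apply'] at h1
      have hyS := h2 k (Nat.lt_succ_self k)
      have hyT := h.iterate_mem hx k
      have : ∃ q q', IsPeriod T par q q' ∧ q ≠ r ∧ par^[k] x ∈ cone T par q := by
        by_contra hno
        push Not at hno
        exact hyS ⟨hyT, hno⟩
      obtain ⟨q, q', hq, hqr, -, m, hm⟩ := this
      cases m with
      | zero =>
        change par^[k] x = q at hm
        rw [hm] at h1
        exact Set.mem_iUnion₂.2 ⟨q, ⟨⟨q', hq⟩, hqr, h1⟩, hx, k, hm⟩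
      | succ m =>
        rw [Function.iterate_succ_apply] at hm
        exact absurd ⟨h1.1, m, hm⟩ (h1.2 q q' hq hqr)
  refine hlin (((LinearGrowth.of_finite hS).union (LinearGrowth.biUnion hQ ?_)).mono hcov)
  rintro q ⟨⟨q', hq⟩, -⟩
  exact hq.linearGrowth hT (hfin q q' hq)

/-! ### Counting the points of a fractal -/

theorem mem_box {N : ℕ} {x : ℤ × ℤ} :
    x ∈ box N ↔ (0 ≤ x.1 ∧ x.1 < N) ∧ 0 ≤ x.2 ∧ x.2 < N := Iff.rfl

theorem box_mono {M N : ℕ} (h : M ≤ N) : box M ⊆ box N := by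
  have h' : (M : ℤ) ≤ N := by exact_mod_cast h
  rintro x ⟨⟨h1, h2⟩, h3, h4⟩
  exact ⟨⟨h1, h2.trans_le h'⟩, h3, h4.trans_le h'⟩

namespace IsGenerator

variable {g : ℕ} {G : Set (ℤ × ℤ)}

theorem subset_box (hG : IsGenerator g G) : G ⊆ box g := hG.2.1.subset

theorem zero_mem (hG : IsGenerator g G) : (0 : ℤ × ℤ) ∈ G := hG.1.subset rfl

theorem finite (hG : IsGenerator g G) : G.Finite := (finite_box g).subset hG.subset_box

theorem stage_subset_box (hG : IsGenerator g G) (i : ℕ) : stage g G i ⊆ box (g ^ (i + 1)) := by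
  induction i with
  | zero => simpa [stage] using hG.subset_box
  | succ i ih =>
    rintro p ⟨m, hm, n, hn, rfl⟩
    obtain ⟨⟨h1, h2⟩, h3, h4⟩ := ih hm
    obtain ⟨⟨h5, h6⟩, h7, h8⟩ := hG.subset_box hn
    have hg : (0 : ℤ) ≤ (g : ℤ) ^ (i + 1) := by positivity
    rw [mem_box]
    push_cast at h2 h4 ⊢
    simp only [Prod.fst_add, Prod.snd_add, Prod.smul_fst, Prod.smul_snd, smul_eq_mul]
    rw [pow_succ (g : ℤ) (i + 1)]
    refine ⟨⟨by positivity, ?_⟩, by positivity, ?_⟩ <;> nlinarith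

theorem stage_mono (hG : IsGenerator g G) : Monotone (stage g G) :=
  monotone_nat_of_le_succ fun _ x hx => ⟨x, hx, 0, hG.zero_mem, by simp⟩

theorem stage_add_inter_box (hG : IsGenerator g G) (i k : ℕ) :
    stage g G (i + k) ∩ box (g ^ (i + 1)) ⊆ stage g G i := by
  induction k with
  | zero => exact Set.inter_subset_left
  | succ k ih =>
    rintro p ⟨⟨m, hm, n, hn, rfl⟩, hp⟩
    simp only [Nat.add_eq] at hm hp ⊢
    have h0 := hG.stage_subset_box _ hm
    obtain ⟨⟨h1, -⟩, h2, -⟩ := h0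
    obtain ⟨⟨h5, h5'⟩, h7, -⟩ := hG.subset_box hn
    have hg : 0 < g := by exact_mod_cast h5.trans_lt h5'
    have hp' := box_mono (Nat.pow_le_pow_right hg (show i + 1 ≤ i + k + 1 by omega)) hp
    obtain ⟨⟨-, h3⟩, -, h4⟩ := hp'
    push_cast at h3 h4
    simp only [Prod.fst_add, Prod.snd_add, Prod.smul_fst, Prod.smul_snd, smul_eq_mul] at h3 h4
    have hgp : (0 : ℤ) < (g : ℤ) ^ (i + k + 1) := by positivity
    have hn0 : n = 0 := by
      refine Prod.ext (show n.1 = 0 from ?_) (show n.2 = 0 from ?_)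
      · have : n.1 < 1 := by
          by_contra hcon
          nlinarith
        exact le_antisymm (by omega) h5
      · have : n.2 < 1 := by
          by_contra hcon
          nlinarith
        exact le_antisymm (by omega) h7
    subst hn0
    rw [smul_zero, add_zero] at hp ⊢
    exact ih ⟨hm, hp⟩

theorem iUnion_stage_inter_box (hG : IsGenerator g G) (i : ℕ) :
    (⋃ j, stage g G j) ∩ box (g ^ (i + 1)) = stage g G i := by
  refine subset_antisymm ?_ fun x hx =>
    ⟨Set.mem_iUnion.2 ⟨i, hx⟩, hG.stage_subset_box i hx⟩
  rintro x ⟨hx, hxb⟩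
  obtain ⟨j, hj⟩ := Set.mem_iUnion.1 hx
  exact hG.stage_add_inter_box i j ⟨hG.stage_mono (Nat.le_add_left j i) hj, hxb⟩

theorem ncard_stage (hG : IsGenerator g G) (i : ℕ) :
    (stage g G i).ncard = G.ncard ^ (i + 1) := by
  induction i with
  | zero => simp [stage]
  | succ i ih =>
    have himg : stage g G (i + 1) = (fun z : (ℤ × ℤ) × (ℤ × ℤ) => z.1 + ((g : ℤ) ^ (i + 1)) • z.2) ''
        (stage g G i ×ˢ G) := by
      ext p
      constructor
      · rintro ⟨m, hm, n, hn, rfl⟩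
        exact ⟨(m, n), ⟨hm, hn⟩, rfl⟩
      · rintro ⟨⟨m, n⟩, ⟨hm, hn⟩, rfl⟩
        exact ⟨m, hm, n, hn, rfl⟩
    have hinj : ∀ K a b x y : ℤ, 0 ≤ a → a < K → 0 ≤ b → b < K → a + K * x = b + K * y →
        a = b ∧ x = y := by
      intro K a b x y h1 h2 h3 h4 he
      have h5 := congrArg (· % K) he
      simp only [Int.add_mul_emod_self_left] at h5
      rw [Int.emod_eq_of_lt h1 h2, Int.emod_eq_of_lt h3 h4] at h5
      subst h5
      exact ⟨rfl, mul_left_cancel₀ (by omega) (add_left_cancel he)⟩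
    rw [himg, Set.InjOn.ncard_image, Set.ncard_prod, ih, pow_succ _ (i + 1)]
    rintro ⟨m, n⟩ ⟨hm, -⟩ ⟨m', n'⟩ ⟨hm', -⟩ he
    obtain ⟨⟨h1, h2⟩, h3, h4⟩ := hG.stage_subset_box _ hm
    obtain ⟨⟨h1', h2'⟩, h3', h4'⟩ := hG.stage_subset_box _ hm'
    push_cast at h2 h4 h2' h4'
    have e1 := congrArg Prod.fst he
    have e2 := congrArg Prod.snd he
    simp only [Prod.fst_add, Prod.snd_add, Prod.smul_fst, Prod.smul_snd, smul_eq_mul] at e1 e2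
    obtain ⟨r1, r2⟩ := hinj _ _ _ _ _ h1 h2 h1' h2' e1
    obtain ⟨r3, r4⟩ := hinj _ _ _ _ _ h3 h4 h3' h4' e2
    exact Prod.ext (Prod.ext r1 r3) (Prod.ext r2 r4)

theorem ncard_lt_sq (hG : IsGenerator g G) : G.ncard < g * g := by
  have hbox : (box g).ncard = g * g := by
    have : (Set.Ico (0 : ℤ) g).ncard = g := by
      rw [← Finset.coe_Ico, Set.ncard_coe_finset, Int.card_Ico]
      simp
    rw [box, Set.ncard_prod, this]
  rw [← hbox]
  exact Set.ncard_lt_ncard hG.2.1 (finite_box g)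

/-- A point of the generator next to the origin lies in the same row or column as the origin, so
that the remaining points still meet all columns or all rows. -/
theorem lt_ncard (hG : IsGenerator g G) {p : ℤ × ℤ} (hp : p ∈ G) (h0 : grid.Adj 0 p) :
    g < G.ncard := by
  have hcard : (Set.Ico (0 : ℤ) g).ncard = g := by
    rw [← Finset.coe_Ico, Set.ncard_coe_finset, Int.card_Ico]
    simp
  have hlt : (G \ {p}).ncard < G.ncard := Set.ncard_sdiff_singleton_lt_of_mem hp hG.finite
  refine lt_of_le_of_lt ?_ hlt
  have h0' : |(0 : ℤ) - p.1| + |(0 : ℤ) - p.2| = 1 := h0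
  have hne : (0 : ℤ × ℤ) ≠ p := h0.ne
  have h0m : (0 : ℤ × ℤ) ∈ G \ {p} := ⟨hG.zero_mem, hne⟩
  -- `p` and the origin agree in one coordinate, so that `p` is not needed for the projection
  have hcase : p.1 = 0 ∨ p.2 = 0 := by
    have h1 := abs_nonneg (0 - p.1)
    have h2 := abs_nonneg (0 - p.2)
    rcases (show |0 - p.1| = 0 ∨ |0 - p.2| = 0 by omega) with h | h <;> rw [abs_eq_zero] at h <;>
      omega
  rcases hcase with hc | hc
  · have hsub : Set.Ico (0 : ℤ) g ⊆ Prod.fst '' (G \ {p}) := by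
      intro x hx
      obtain ⟨y, hy⟩ := hG.2.2.1 x hx
      by_cases hyp : (x, y) = p
      · exact ⟨0, h0m, by rw [← hyp] at hc; exact hc.symm⟩
      · exact ⟨(x, y), ⟨hy, hyp⟩, rfl⟩
    calc g = (Set.Ico (0 : ℤ) g).ncard := hcard.symm
      _ ≤ _ := Set.ncard_le_ncard hsub (hG.finite.sdiff.image _)
      _ ≤ _ := Set.ncard_image_le hG.finite.sdiff
  · have hsub : Set.Ico (0 : ℤ) g ⊆ Prod.snd '' (G \ {p}) := by
      intro y hy
      obtain ⟨x, hx⟩ := hG.2.2.2 y hy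
      by_cases hxp : (x, y) = p
      · exact ⟨0, h0m, by rw [← hxp] at hc; exact hc.symm⟩
      · exact ⟨(x, y), ⟨hx, hxp⟩, rfl⟩
    calc g = (Set.Ico (0 : ℤ) g).ncard := hcard.symm
      _ ≤ _ := Set.ncard_le_ncard hsub (hG.finite.sdiff.image _)
      _ ≤ _ := Set.ncard_image_le hG.finite.sdiff

theorem lt_ncard_of_connected (hG : IsGenerator g G) (hg : 1 < g)
    (h : (fullGridGraph (⋃ i, stage g G i)).Connected) : g < G.ncard := by
  have hGT : G ⊆ ⋃ i, stage g G i := Set.subset_iUnion (fun i => stage g G i) 0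
  obtain ⟨z, hz, hz0⟩ := Set.exists_of_ssubset hG.1
  obtain ⟨w⟩ := h.preconnected ⟨0, hGT hG.zero_mem⟩ ⟨z, hGT hz⟩
  cases w with
  | nil => exact absurd rfl hz0
  | @cons _ v _ hadj _ =>
    have hadj' : grid.Adj 0 v.1 := hadj
    refine hG.lt_ncard (p := v.1) ?_ hadj'
    have h1 := hG.iUnion_stage_inter_box 0
    rw [zero_add, pow_one] at h1
    change _ = G at h1
    refine h1.subset ⟨v.2, ?_⟩
    obtain ⟨j, hj⟩ := Set.mem_iUnion.1 v.2
    obtain ⟨⟨h2, -⟩, h3, -⟩ := hG.stage_subset_box j hj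
    have h4 : |(0 : ℤ) - v.1.1| + |(0 : ℤ) - v.1.2| = 1 := hadj'
    rw [zero_sub, zero_sub, abs_neg, abs_neg, abs_of_nonneg h2, abs_of_nonneg h3] at h4
    have hg' : (1 : ℤ) < g := by exact_mod_cast hg
    exact ⟨⟨h2, by omega⟩, h3, by omega⟩

end IsGenerator

theorem exists_mul_pow_lt_pow {a b : ℕ} (hab : a < b) (k : ℕ) : ∃ i, k * a ^ i < b ^ i := by
  rcases Nat.eq_zero_or_pos a with rfl | ha
  · exact ⟨1, by simpa using hab⟩
  have ha' : (0 : ℝ) < a := by exact_mod_cast ha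
  have h1 : (1 : ℝ) < (b : ℝ) / a := by
    rw [one_lt_div ha']
    exact_mod_cast hab
  obtain ⟨i, hi⟩ := pow_unbounded_of_one_lt (k : ℝ) h1
  refine ⟨i, ?_⟩
  rw [div_pow, lt_div_iff₀ (by positivity)] at hi
  exact_mod_cast hi

/-- A fractal whose generator has more than `g` points does not grow linearly. -/
theorem IsGenerator.not_linearGrowth {g : ℕ} {G : Set (ℤ × ℤ)} (hG : IsGenerator g G)
    (hg : 1 < g) (hcard : g < G.ncard) : ¬ LinearGrowth (⋃ i, stage g G i) := by
  rintro ⟨k, hk⟩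
  obtain ⟨i, hi⟩ := exists_mul_pow_lt_pow hcard (k * g)
  have h1 := hk (g ^ (i + 1)) (by positivity)
  rw [hG.iUnion_stage_inter_box, hG.ncard_stage] at h1
  have h2 : G.ncard ^ i ≤ G.ncard ^ (i + 1) := Nat.pow_le_pow_right (by omega) (by omega)
  have h3 : k * g ^ (i + 1) = k * g * g ^ i := by ring
  omega

/-- The density of a fractal is zero, so that it contains no two-dimensional lattice sector. -/
theorem IsGenerator.not_sector {g : ℕ} {G : Set (ℤ × ℤ)} (hG : IsGenerator g G) (hg : 1 < g)
    {s v w : ℤ × ℤ} (hT : ∀ k l : ℕ, s + k • v + l • w ∈ ⋃ i, stage g G i)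
    (hinj : Function.Injective fun z : ℕ × ℕ => s + z.1 • v + z.2 • w) : False := by
  obtain ⟨M, hM⟩ : ∃ M : ℕ, (s.1 ≤ M ∧ s.2 ≤ M) ∧ (v.1 ≤ M ∧ v.2 ≤ M) ∧ w.1 ≤ M ∧ w.2 ≤ M :=
    ⟨(|s.1| + |s.2| + |v.1| + |v.2| + |w.1| + |w.2|).toNat, by
      have := le_abs_self s.1
      have := le_abs_self s.2
      have := le_abs_self v.1
      have := le_abs_self v.2
      have := le_abs_self w.1
      have := le_abs_self w.2
      have := abs_nonneg s.1
      have := abs_nonneg s.2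
      have := abs_nonneg v.1
      have := abs_nonneg v.2
      have := abs_nonneg w.1
      have := abs_nonneg w.2
      omega⟩
  obtain ⟨L, hL⟩ : ∃ L : ℕ, 3 * M + 1 ≤ g ^ L := ⟨3 * M + 1, (Nat.lt_pow_self hg).le⟩
  obtain ⟨i, hi⟩ := exists_mul_pow_lt_pow hG.ncard_lt_sq (G.ncard ^ (L + 1))
  have hsub : (fun z : ℕ × ℕ => s + z.1 • v + z.2 • w) '' (Set.Iio (g ^ i) ×ˢ Set.Iio (g ^ i)) ⊆
      (⋃ i, stage g G i) ∩ box (g ^ (i + L + 1)) := by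
    rintro _ ⟨⟨k, l⟩, ⟨hk, hl⟩, rfl⟩
    refine ⟨hT k l, ?_⟩
    obtain ⟨j, hj⟩ := Set.mem_iUnion.1 (hT k l)
    obtain ⟨⟨h1, -⟩, h2, -⟩ := hG.stage_subset_box j hj
    have hk' : (k : ℤ) + 1 ≤ (g : ℤ) ^ i := by exact_mod_cast hk
    have hl' : (l : ℤ) + 1 ≤ (g : ℤ) ^ i := by exact_mod_cast hl
    have hL' : 3 * (M : ℤ) + 1 ≤ (g : ℤ) ^ L := by exact_mod_cast hL
    have hg' : (1 : ℤ) ≤ g := by exact_mod_cast hg.le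
    have hpos : (1 : ℤ) ≤ (g : ℤ) ^ i := one_le_pow₀ hg'
    have hposL : (1 : ℤ) ≤ (g : ℤ) ^ L := one_le_pow₀ hg'
    have hbound : ∀ a b c : ℤ, a ≤ M → b ≤ M → c ≤ M →
        a + k * b + l * c < (g : ℤ) ^ (i + L + 1) := by
      intro a b c ha hb hc
      have e1 : (k : ℤ) * b ≤ k * M := mul_le_mul_of_nonneg_left hb (by positivity)
      have e2 : (l : ℤ) * c ≤ l * M := mul_le_mul_of_nonneg_left hc (by positivity)
      have e3 : (k : ℤ) * M ≤ (g : ℤ) ^ i * M := by gcongr; omega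
      have e4 : (l : ℤ) * M ≤ (g : ℤ) ^ i * M := by gcongr; omega
      have e5 : (1 : ℤ) * M ≤ (g : ℤ) ^ i * M := by gcongr
      have e6 : (g : ℤ) ^ i * (3 * M + 1) ≤ (g : ℤ) ^ i * (g : ℤ) ^ L := by gcongr
      have e7 : (g : ℤ) ^ i * (g : ℤ) ^ L * 1 ≤ (g : ℤ) ^ i * (g : ℤ) ^ L * g := by gcongr
      rw [pow_succ, pow_add]
      linarith
    refine ⟨⟨h1, ?_⟩, h2, ?_⟩
    · have := hbound s.1 v.1 w.1 hM.1.1 hM.2.1.1 hM.2.2.1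
      simp only [Prod.fst_add, Prod.smul_fst]
      push_cast
      simpa only [nsmul_eq_mul] using this
    · have := hbound s.2 v.2 w.2 hM.1.2 hM.2.1.2 hM.2.2.2
      simp only [Prod.snd_add, Prod.smul_snd]
      push_cast
      simpa only [nsmul_eq_mul] using this
  have h1 := Set.ncard_le_ncard hsub ((finite_box _).inter_of_right _)
  rw [Set.ncard_image_of_injective _ hinj, Set.ncard_prod, Set.ncard_Iio_nat,
    hG.iUnion_stage_inter_box, hG.ncard_stage, ← mul_pow] at h1
  have h2 : G.ncard ^ (i + L + 1) = G.ncard ^ (L + 1) * G.ncard ^ i := by ring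
  omega

/-! ### Tile assembly systems for trees -/

/-- The positions of a block and of its neighbours lie in a window of bounded size around the
corner of the block. -/
theorem sub_smul_mem_Icc {c : ℕ} (hc : 0 < c) {x q : ℤ × ℤ} {d : Dir}
    (hx : blk c x = q ∨ blk c x = q + d.vec) :
    x - (c : ℤ) • q ∈ Set.Icc ((-c, -c) : ℤ × ℤ) (2 * c, 2 * c) := by
  have hc' : (0 : ℤ) < c := by exact_mod_cast hc
  have h1 := Int.emod_add_mul_ediv x.1 c
  have h2 := Int.emod_add_mul_ediv x.2 c
  have h3 := Int.emod_nonneg x.1 hc'.ne'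
  have h4 := Int.emod_nonneg x.2 hc'.ne'
  have h5 := Int.emod_lt_of_pos x.1 hc'
  have h6 := Int.emod_lt_of_pos x.2 hc'
  have key : ∀ e1 e2 : ℤ, (-1 ≤ e1 ∧ e1 ≤ 1) → (-1 ≤ e2 ∧ e2 ≤ 1) → blk c x = q + (e1, e2) →
      x - (c : ℤ) • q ∈ Set.Icc ((-c, -c) : ℤ × ℤ) (2 * c, 2 * c) := by
    intro e1 e2 he1 he2 he
    have h7 : x.1 / (c : ℤ) = q.1 + e1 := congrArg Prod.fst he
    have h8 : x.2 / (c : ℤ) = q.2 + e2 := congrArg Prod.snd he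
    rw [h7] at h1
    rw [h8] at h2
    refine ⟨⟨?_, ?_⟩, ?_, ?_⟩ <;>
      simp only [Prod.fst_sub, Prod.snd_sub, Prod.smul_fst, Prod.smul_snd, smul_eq_mul] <;> nlinarith
  rcases hx with hx | hx
  · exact key 0 0 (by norm_num) (by norm_num) (by rw [hx]; simp)
  · cases d
    exacts [key 0 1 (by norm_num) (by norm_num) hx, key 1 0 (by norm_num) (by norm_num) hx,
      key 0 (-1) (by norm_num) (by norm_num) hx, key (-1) 0 (by norm_num) (by norm_num) hx]

universe u

/-- In a tree whose scaling strictly self-assembles, all but finitely many cones fall into finitely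
many classes up to translation: a window of bounded size carries only finitely many movies. -/
theorem TAS.StrictlySelfAssembles.exists_key {A : Type u} {𝒯 : TAS A} {T : Set (ℤ × ℤ)} {c : ℕ} (hc : 0 < c)
    (hself : 𝒯.StrictlySelfAssembles (scaling c T)) {a : ℕ → Config A}
    (ha : 𝒯.IsFillingSeq (scaling c T) a) {r : ℤ × ℤ} {par : ℤ × ℤ → ℤ × ℤ}
    (hpar : IsParent T r par) :
    ∃ (ι : Type u) (_ : Finite ι) (E : Set (ℤ × ℤ)) (key : ℤ × ℤ → ι), E.Finite ∧
      ∀ q ∈ T \ E, ∀ q' ∈ T \ E, key q = key q' →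
        ∀ y ∈ cone T par q', y + (q - q') ∈ cone T par q := by
  classical
  let D : Set (ℤ × ℤ) := Set.Icc (-c, -c) (2 * c, 2 * c)
  have hD : Finite D := (Set.finite_Icc _ _).to_subtype
  have hfin : Finite 𝒯.tiles := 𝒯.tiles_finite.to_subtype
  have htile : ∀ x, ∃ o : Option 𝒯.tiles, limit a x = o.map Subtype.val := by
    intro x
    by_cases hx : x ∈ dom (limit a)
    · rw [dom_limit ha.subassembly, Set.mem_iUnion] at hx
      obtain ⟨i, hi⟩ := hx
      rw [limit_apply ha.subassembly hi]
      obtain ⟨t, ht⟩ := Option.ne_none_iff_exists'.1 hi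
      exact ⟨some ⟨t, (ha.step i).1.1.1 x t ht⟩, ht⟩
    · exact ⟨none, notMem_dom.1 hx⟩
  choose tile htile using htile
  have hdir : ∀ q, ∃ d : Dir, q ∈ T → q ≠ r → par q = q + d.vec := by
    intro q
    by_cases hq : q ∈ T ∧ q ≠ r
    · obtain ⟨d, hd⟩ := exists_vec_of_grid_adj (hpar.adj q hq.1 hq.2)
      exact ⟨d, fun _ _ => hd⟩
    · exact ⟨.N, fun h1 h2 => absurd ⟨h1, h2⟩ hq⟩
  choose dir hdir using hdir
  let E : Set (ℤ × ℤ) := {r} ∪ ⋃ x ∈ dom 𝒯.seed, {q | blk c x ∈ cone T par q}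
  have hseedT : ∀ x ∈ dom 𝒯.seed, blk c x ∈ T := by
    intro x hx
    rw [← ha.zero] at hx
    exact ha.dom_subset 0 hx
  have hE : E.Finite := (Set.finite_singleton r).union
    (𝒯.seed_finite.biUnion fun x hx => hpar.finite_ancestors (hseedT x hx))
  -- the movie at `q`, read off the window around the block of `q`
  let key : ℤ × ℤ → Dir × (D → Option 𝒯.tiles) × (D → Prop) × (D → D → Prop) := fun q =>
    (dir q, fun o => tile ((c : ℤ) • q + o.1), fun o => arrival a ((c : ℤ) • q + o.1) = 0,
      fun o o' => arrival a ((c : ℤ) • q + o.1) ≤ arrival a ((c : ℤ) • q + o'.1))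
  have : Finite (Dir × (D → Option 𝒯.tiles) × (D → Prop) × (D → D → Prop)) := inferInstance
  refine ⟨_, this, E, key, hE, ?_⟩
  rintro q ⟨hq, hqE⟩ q' ⟨hq', hqE'⟩ hk
  have hkd : dir q = dir q' := congrArg (fun k => k.1) hk
  have hkt : ∀ o : D, tile ((c : ℤ) • q + o.1) = tile ((c : ℤ) • q' + o.1) :=
    fun o => congrFun (congrArg (fun k => k.2.1) hk) o
  have hks : ∀ o : D, (arrival a ((c : ℤ) • q + o.1) = 0) = (arrival a ((c : ℤ) • q' + o.1) = 0) :=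
    fun o => congrFun (congrArg (fun k => k.2.2.1) hk) o
  have hko : ∀ o o' : D, (arrival a ((c : ℤ) • q + o.1) ≤ arrival a ((c : ℤ) • q + o'.1)) =
      (arrival a ((c : ℤ) • q' + o.1) ≤ arrival a ((c : ℤ) • q' + o'.1)) :=
    fun o o' => congrFun (congrFun (congrArg (fun k => k.2.2.2) hk) o) o'
  have hqr : q ≠ r := fun h => hqE (.inl h)
  have hqr' : q' ≠ r := fun h => hqE' (.inl h)
  have hC := hpar.isBranch_cone hq hqr (hdir q hq hqr)
  have hC' := hpar.isBranch_cone hq' hqr' (hdir q' hq' hqr')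
  rw [← hkd] at hC'
  have hx1 : ∀ x : ℤ × ℤ, (c : ℤ) • q + (x - (c : ℤ) • q) = x := fun x => by abel
  have hx2 : ∀ x : ℤ × ℤ, (c : ℤ) • q' + (x - (c : ℤ) • q) = x - (c : ℤ) • (q - q') := fun x => by
    rw [smul_sub]; abel
  refine TAS.branch_subset_of_sameMovie hc hself ha hC hC'
    (fun x hx h => hqE (.inr (Set.mem_biUnion hx h)))
    (fun x hx h => hqE' (.inr (Set.mem_biUnion hx h))) ⟨fun x hx => ?_, fun x hx => ?_,
      fun x hx y hy => ?_⟩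
  · have := hkt ⟨_, sub_smul_mem_Icc hc hx⟩
    rw [hx1, hx2] at this
    rw [htile, htile, this]
  · have := hks ⟨_, sub_smul_mem_Icc hc hx⟩
    rw [hx1, hx2] at this
    exact iff_of_eq this
  · have := hko ⟨_, sub_smul_mem_Icc hc hx⟩ ⟨_, sub_smul_mem_Icc hc hy⟩
    rw [hx1, hx2, hx1, hx2] at this
    exact iff_of_eq this

theorem infinite_scaling {c : ℕ} (hc : 0 < c) {T : Set (ℤ × ℤ)} (hT : T.Infinite) :
    (scaling c T).Infinite := by
  intro hfin
  refine hT ((hfin.image (blk c)).subset fun y hy => ?_)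
  have hyb : blk c ((c : ℤ) • y) = y := by
    have := blk_add_smul hc 0 y
    rwa [zero_add, show blk c 0 = 0 by simp [blk], zero_add] at this
  exact ⟨(c : ℤ) • y, by rw [mem_scaling, hyb]; exact hy, hyb⟩

end ATAM

theorem mainTheorem4 (A : Type*) (T : Set (ℤ × ℤ)) (hT : ATAM.IsTreeFractal T)
    (c : ℕ) (hc : 0 < c) :
    ¬ ∃ 𝒯 : ATAM.TAS A, 𝒯.StrictlySelfAssembles (ATAM.scaling c T) := by
  rintro ⟨𝒯, hself⟩
  obtain ⟨⟨g, hg, G, hG, rfl⟩, htree⟩ := hT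
  have hlin := hG.not_linearGrowth hg (hG.lt_ncard_of_connected hg htree.connected)
  have hinf : (⋃ i, ATAM.stage g G i).Infinite := fun hfin =>
    hlin (ATAM.LinearGrowth.of_finite hfin)
  have hzero : (0 : ℤ × ℤ) ∈ ⋃ i, ATAM.stage g G i := Set.mem_iUnion.2 ⟨0, hG.zero_mem⟩
  obtain ⟨a, h0, hstep, hfill⟩ := hself.exists_seq (ATAM.infinite_scaling hc hinf)
  obtain ⟨par, hpar⟩ := ATAM.exists_isParent htree hzero
  obtain ⟨ι, hι, E, key, hE, hkey⟩ := hself.exists_key hc ⟨h0, hstep, hfill⟩ hpar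
  have hpos : ∀ x ∈ ⋃ i, ATAM.stage g G i, 0 ≤ x.1 ∧ 0 ≤ x.2 := by
    intro x hx
    obtain ⟨i, hi⟩ := Set.mem_iUnion.1 hx
    have hb := ATAM.mem_box.1 (hG.stage_subset_box i hi)
    exact ⟨hb.1.1, hb.2.1⟩
  rcases hpar.sector_or_linearGrowth hpos hE key hkey with ⟨s, v, w, hs, hinj⟩ | hl
  · exact hG.not_sector hg hs hinj
  · exact hlin hl
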